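/- Let $\Bbbk$ be a field, let $G$ be a finite simple graph, and let $\pi=\{W_1,\dots,W_r\}$ be a clique partition of $G$: the $W_i$ are nonempty, pairwise disjoint cliques of $G$ with $\bigcup_i W_i=V(G)$. Write $W_i=\{x_{i,1},\dots,x_{i,|W_i|}\}$. Let $G^\pi$ be the clique-whiskered graph, with vertex set $V(G)\cup\{w_1,\dots,w_r\}$ and edge set $E(G)\cup\bigcup_{i=1}^r\{\{x,w_i\}:x\in W_i\}$, and let $W(G)$ be the whisker graph, obtained from $G$ by attaching one new vertex $y_{i,j}$ to each $x_{i,j}$ by the edge $\{x_{i,j},y_{i,j}\}$. Let $S=\Bbbk[x_{i,j},w_i]$ and $S'=\Bbbk[x_{i,j},y_{i,j}]$ be the standard graded polynomial rings whose variables are the vertices of $G^\pi$ and of $W(G)$, and let $I(G^\pi)\subset S$ and $I(W(G))\subset S'$ be the edge ideals, generated by the products $uv$ for the edges $\{u,v\}$. Let $$\mathbf y=y_{1,2}-y_{1,1},\ldots,y_{1,|W_1|}-y_{1,1},\ \ldots,\ y_{r,2}-y_{r,1},\ldots,y_{r,|W_r|}-y_{r,1},$$ where a block with $|W_i|=1$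 contributes no element. Then: 1. $\mathbf y$ is a regular sequence on $S'/I(W(G))$. 2. There is an isomorphism of $\Bbbk$-algebras $S'/(I(W(G))+(\mathbf y))\cong S/I(G^\pi)$ with $x_{i,j}\mapsto x_{i,j}$ and $y_{i,j}\mapsto w_i$ for all $i,j$. 3. $\beta_{i,j}(S/I(G^\pi))=\beta_{i,j}(S'/I(W(G)))$ for all $i,j$. Here the graded Betti number $\beta_{i,j}(M)$ of a finitely generated graded module $M$ over a standard graded polynomial ring $R$ is the number of summands $R(-j)$ in homological degree $i$ of a graded minimal free resolution of $M$. Explicitly: both modules have graded minimal free resolutions, and any graded minimal free resolution of $S/I(G^\pi)$ over $S$ and any one of $S'/I(W(G))$ over $S'$ have the same number of summands generated in degree $j$ in homological degree $i$. -/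

import Mathlib

open MvPolynomial

/-- A partition `W_1, …, W_r` of the vertex set of a graph into (nonempty) cliques. -/
structure CliquePartition {V : Type*} (G : SimpleGraph V) where
  r : ℕ
  block : Fin r → Finset V
  block_nonempty : ∀ i, (block i).Nonempty
  isClique : ∀ i, G.IsClique (block i : Set V)
  pairwise_disjoint : Pairwise fun i j => Disjoint (block i) (block j)
  covers : ∀ v, ∃ i, v ∈ block i

/-- The clique-whiskered graph `G^π`: the vertex `Sum.inl v` is the vertex `v` of `G`, and
`Sum.inr i` is the new vertex `w_i`, which is joined to exactly the vertices of `W_i`. -/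
def cliqueWhiskeredGraph {V : Type*} (G : SimpleGraph V) (π : CliquePartition G) :
    SimpleGraph (V ⊕ Fin π.r) where
  Adj
    | .inl u, .inl v => G.Adj u v
    | .inl u, .inr i => u ∈ π.block i
    | .inr i, .inl u => u ∈ π.block i
    | .inr _, .inr _ => False
  symm := ⟨by
    rintro (u | i) (v | j) h
    · exact SimpleGraph.Adj.symm h
    · exact h
    · exact h
    · exact h⟩
  loopless := ⟨by
    rintro (u | i) h
    · exact G.irrefl h
    · exact h⟩

/-- The whisker graph `W(G)`: the vertex `Sum.inl v` is the vertex `v` of `G`, and `Sum.inr v`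
is the new vertex attached to `v`. -/
def whiskerGraph {V : Type*} (G : SimpleGraph V) : SimpleGraph (V ⊕ V) where
  Adj
    | .inl u, .inl v => G.Adj u v
    | .inl u, .inr v => u = v
    | .inr v, .inl u => u = v
    | .inr _, .inr _ => False
  symm := ⟨by
    rintro (u | i) (v | j) h
    · exact SimpleGraph.Adj.symm h
    · exact h
    · exact h
    · exact h⟩
  loopless := ⟨by
    rintro (u | i) h
    · exact G.irrefl h
    · exact h⟩

/-- The edge ideal of a graph, in the polynomial ring whose variables are the vertices. -/
noncomputable def edgeIdeal (𝕜 : Type*) [Field 𝕜] {V : Type*} (G : SimpleGraph V) :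
    Ideal (MvPolynomial V 𝕜) :=
  Ideal.span {p | ∃ u v, G.Adj u v ∧ p = X u * X v}

/-- The sequence `y_{1,2} - y_{1,1}, …, y_{1,|W_1|} - y_{1,1}, …, y_{r,2} - y_{r,1}, …,
y_{r,|W_r|} - y_{r,1}`, where `x i` enumerates the vertices of `W_i` and `y_{i,j}` is the
variable of the new vertex attached to `x i j`. Indices start at `0` here, and `tail` drops the
first index of each clique. -/
noncomputable def whiskerDifferences (𝕜 : Type*) [Field 𝕜] {V : Type*} {G : SimpleGraph V}
    (π : CliquePartition G) (x : ∀ i, Fin (π.block i).card ≃ {v // v ∈ π.block i}) :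
    List (MvPolynomial (V ⊕ V) 𝕜) :=
  (List.finRange π.r).flatMap fun i =>
    (List.finRange (π.block i).card).tail.map fun j =>
      X (Sum.inr (x i j).1) -
        X (Sum.inr (x i ⟨0, Finset.card_pos.mpr (π.block_nonempty i)⟩).1)

section Betti

variable {𝕜 σ : Type*} [Field 𝕜]

/-- The standard `ℤ`-grading of the polynomial ring: all variables have degree `1`. -/
noncomputable def polyGrading (𝕜 σ : Type*) [Field 𝕜] : ℤ → Submodule 𝕜 (MvPolynomial σ 𝕜)
  | .ofNat n => homogeneousSubmodule σ 𝕜 n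
  | .negSucc _ => ⊥

/-- The grading of `S/I` induced by the standard grading of `S` (for a homogeneous ideal `I`). -/
noncomputable def quotGrading (I : Ideal (MvPolynomial σ 𝕜)) (j : ℤ) : Submodule 𝕜 (MvPolynomial σ 𝕜 ⧸ I) :=
  (polyGrading 𝕜 σ j).map (Ideal.Quotient.mkₐ 𝕜 I).toLinearMap

/-- The degree `j` part of the graded free module `⨁ a, S(-deg a)`, where
`S(-c)_j = S_{j-c}`. -/
noncomputable def freeGrading (𝕜 σ : Type*) [Field 𝕜] {n : ℕ} (deg : Fin n → ℤ) (j : ℤ) :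
    Submodule 𝕜 (Fin n → MvPolynomial σ 𝕜) :=
  Submodule.pi Set.univ fun a => polyGrading 𝕜 σ (j - deg a)

/-- A graded minimal free resolution `⋯ → F_2 → F_1 → F_0 → M → 0` of a graded module `M` (with
degree `j` part `𝓜 j`) over a standard graded polynomial ring `S`: each
`F_i = ⨁ a, S(-deg i a)` has finite rank, all maps are homogeneous of degree `0`, the sequence is
exact, and `d i : F_{i+1} → F_i` has its image in `𝔪 F_i`, where `𝔪` is the ideal generated by
the variables. -/
structure MinimalGradedFreeResolution {M : Type*} [AddCommGroup M] [Module 𝕜 M]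
    [Module (MvPolynomial σ 𝕜) M] (𝓜 : ℤ → Submodule 𝕜 M) where
  rank : ℕ → ℕ
  deg : ∀ i, Fin (rank i) → ℤ
  d : ∀ i, (Fin (rank (i + 1)) → MvPolynomial σ 𝕜) →ₗ[MvPolynomial σ 𝕜]
    (Fin (rank i) → MvPolynomial σ 𝕜)
  aug : (Fin (rank 0) → MvPolynomial σ 𝕜) →ₗ[MvPolynomial σ 𝕜] M
  d_homogeneous : ∀ i j, ∀ v ∈ freeGrading 𝕜 σ (deg (i + 1)) j,
    d i v ∈ freeGrading 𝕜 σ (deg i) j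
  aug_homogeneous : ∀ j, ∀ v ∈ freeGrading 𝕜 σ (deg 0) j, aug v ∈ 𝓜 j
  aug_surjective : Function.Surjective aug
  exact_zero : Function.Exact (d 0) aug
  exact_succ : ∀ i, Function.Exact (d (i + 1)) (d i)
  minimal : ∀ i, LinearMap.range (d i) ≤
    Ideal.span (Set.range (X : σ → MvPolynomial σ 𝕜)) •
      (⊤ : Submodule (MvPolynomial σ 𝕜) (Fin (rank i) → MvPolynomial σ 𝕜))

/-- The graded Betti number `β_{i,j}` read off from a graded minimal free resolution: the number
of summands `S(-j)` in `F_i`. -/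
def MinimalGradedFreeResolution.betti {M : Type*} [AddCommGroup M] [Module 𝕜 M]
    [Module (MvPolynomial σ 𝕜) M] {𝓜 : ℤ → Submodule 𝕜 M}
    (F : MinimalGradedFreeResolution (σ := σ) 𝓜) (i : ℕ) (j : ℤ) : ℕ :=
  Fintype.card {a : Fin (F.rank i) // F.deg i a = j}

/-- `β` is the table of graded Betti numbers of `M`: `M` has a graded minimal free resolution, and
every graded minimal free resolution of `M` has exactly `β i j` summands `S(-j)` in homological
degree `i`. -/
def IsGradedBettiTable (𝕜 σ : Type*) [Field 𝕜] {M : Type*} [AddCommGroup M] [Module 𝕜 M]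
    [Module (MvPolynomial σ 𝕜) M] (𝓜 : ℤ → Submodule 𝕜 M) (β : ℕ → ℤ → ℕ) : Prop :=
  Nonempty (MinimalGradedFreeResolution (σ := σ) 𝓜) ∧
    ∀ (F : MinimalGradedFreeResolution (σ := σ) 𝓜) (i : ℕ) (j : ℤ), F.betti i j = β i j

end Betti

/-! Dividing by `y_a - y_b` glues two whisker vertices. After some gluings, the quotient is again
the quotient by an edge ideal, that of `G` with new vertices joined to the fibres of a map `c`
(`fiberWhiskerGraph`). In any graph, `X a - X b` is a nonzerodivisor modulo the edge ideal when
every neighbour of `a` is adjacent to every neighbour of `b` (`mem_edgeIdeal_of_sub_mul_mem`): a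
minimal vertex cover containing both would miss a neighbour of each, and these two are adjacent.
Here the two neighbourhoods are disjoint subsets of one clique, so the condition holds at each
stage. This gives regularity; gluing along `π.index` gives the quotient.

For Betti numbers, the differences are also regular on the polynomial ring, and they generate the
kernel of the identification of variables. So a minimal graded resolution of `S'/I(W(G))` stays
exact, minimal and of the same degrees modulo them (`exists_specialized_resolution`). The comparison
with arbitrary resolutions uses uniqueness of minimal graded covers, applied to successive syzygy
modules (`betti_eq_of_equiv`); existence comes from iterating minimal covers. -/

/-! ### Graded pieces of polynomial rings and graded free modules. -/

section GradedPieces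

variable {𝕜 σ : Type*} [Field 𝕜]

theorem mem_polyGrading {j : ℤ} {p : MvPolynomial σ 𝕜} :
    p ∈ polyGrading 𝕜 σ j ↔ ∀ m, coeff m p ≠ 0 → (m.degree : ℤ) = j := by
  cases j with
  | ofNat n =>
    simp only [polyGrading, mem_homogeneousSubmodule, IsHomogeneous, IsWeightedHomogeneous,
      Int.ofNat_eq_natCast, Nat.cast_inj, Finsupp.degree_eq_weight_one]
    rfl
  | negSucc n =>
    simp only [polyGrading, Submodule.mem_bot]
    constructor
    · rintro rfl m h
      simp at h
    · intro h
      ext m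
      by_contra hm
      have := h m (by simpa using hm)
      omega

theorem mul_mem_polyGrading {i j : ℤ} {p q : MvPolynomial σ 𝕜} (hp : p ∈ polyGrading 𝕜 σ i)
    (hq : q ∈ polyGrading 𝕜 σ j) : p * q ∈ polyGrading 𝕜 σ (i + j) := by
  classical
  rw [mem_polyGrading] at *
  intro m hm
  rw [coeff_mul] at hm
  obtain ⟨⟨a, b⟩, hab, h⟩ := Finset.exists_ne_zero_of_sum_ne_zero hm
  rw [Finset.HasAntidiagonal.mem_antidiagonal] at hab
  have h1 := hp a (left_ne_zero_of_mul h)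
  have h2 := hq b (right_ne_zero_of_mul h)
  simp only at hab
  rw [← hab, map_add]
  push_cast
  omega

theorem C_mem_polyGrading (c : 𝕜) : (C c : MvPolynomial σ 𝕜) ∈ polyGrading 𝕜 σ 0 := by
  classical
  rw [mem_polyGrading]
  intro m hm
  rw [coeff_C] at hm
  have : m = 0 := by
    by_contra h
    exact hm (if_neg (Ne.symm h))
  simp [this]

/-- The homogeneous component of a polynomial of an integral degree. -/
noncomputable def polyComponent (j : ℤ) : MvPolynomial σ 𝕜 →ₗ[𝕜] MvPolynomial σ 𝕜 :=
  if 0 ≤ j then homogeneousComponent j.toNat else 0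

theorem coeff_polyComponent (j : ℤ) (p : MvPolynomial σ 𝕜) (m : σ →₀ ℕ) :
    coeff m (polyComponent j p) = if (m.degree : ℤ) = j then coeff m p else 0 := by
  unfold polyComponent
  split_ifs with h1 h2 h2
  · rw [coeff_homogeneousComponent, if_pos (by omega)]
  · rw [coeff_homogeneousComponent, if_neg (by omega)]
  · omega
  · simp

theorem polyComponent_mem (j : ℤ) (p : MvPolynomial σ 𝕜) :
    polyComponent j p ∈ polyGrading 𝕜 σ j := by
  rw [mem_polyGrading]
  intro m hm
  rw [coeff_polyComponent] at hm
  by_contra h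
  exact hm (if_neg h)

theorem polyComponent_of_mem {j : ℤ} {p : MvPolynomial σ 𝕜} (hp : p ∈ polyGrading 𝕜 σ j) :
    polyComponent j p = p := by
  rw [mem_polyGrading] at hp
  ext m
  rw [coeff_polyComponent]
  split_ifs with h
  · rfl
  · by_contra h'
    exact h (hp m (Ne.symm h'))

theorem polyComponent_of_mem_ne {i j : ℤ} {p : MvPolynomial σ 𝕜} (hp : p ∈ polyGrading 𝕜 σ j)
    (hij : i ≠ j) : polyComponent i p = 0 := by
  rw [mem_polyGrading] at hp
  ext m
  rw [coeff_polyComponent, coeff_zero]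
  split_ifs with h
  · by_contra h'
    exact hij (h.symm.trans (hp m h'))
  · rfl

theorem exists_polyComponent_eq_zero (p : MvPolynomial σ 𝕜) :
    ∃ s : Finset ℤ, ∀ j ∉ s, polyComponent j p = 0 := by
  classical
  refine ⟨p.support.image fun m => (m.degree : ℤ), fun j hj => ?_⟩
  ext m
  rw [coeff_polyComponent, coeff_zero]
  split_ifs with h
  · by_contra h'
    exact hj (Finset.mem_image.mpr ⟨m, mem_support_iff.mpr h', h⟩)
  · rfl

theorem sum_polyComponent {s : Finset ℤ} {p : MvPolynomial σ 𝕜}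
    (hs : ∀ j ∉ s, polyComponent j p = 0) : ∑ j ∈ s, polyComponent j p = p := by
  ext m
  rw [coeff_sum]
  simp_rw [coeff_polyComponent]
  rw [Finset.sum_ite_eq]
  split_ifs with h
  · rfl
  · have := congrArg (coeff m) (hs _ h)
    rw [coeff_polyComponent, if_pos rfl] at this
    simpa using this.symm

theorem mem_span_range_X {p : MvPolynomial σ 𝕜} :
    p ∈ Ideal.span (Set.range (X : σ → MvPolynomial σ 𝕜)) ↔ constantCoeff p = 0 := by
  have h := mem_pow_idealOfVars_iff' (σ := σ) 1 p
  rw [pow_one] at h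
  rw [h, constantCoeff_eq]
  constructor
  · intro h
    exact h 0 (by simp)
  · intro h m hm
    rw [Nat.lt_one_iff, Finsupp.degree_eq_zero_iff] at hm
    rw [hm, h]

theorem constantCoeff_eq_zero_of_mem_polyGrading {j : ℤ} {p : MvPolynomial σ 𝕜}
    (hp : p ∈ polyGrading 𝕜 σ j) (hj : j ≠ 0) : constantCoeff p = 0 := by
  by_contra h
  have := mem_polyGrading.mp hp 0 h
  simp at this
  exact hj this.symm

theorem eq_zero_of_mem_polyGrading {j : ℤ} {p : MvPolynomial σ 𝕜} (hp : p ∈ polyGrading 𝕜 σ j)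
    (hj : j ≤ 0) (h0 : constantCoeff p = 0) : p = 0 := by
  ext m
  by_contra h
  have h1 := mem_polyGrading.mp hp m h
  have h2 : m.degree = 0 := by omega
  rw [Finsupp.degree_eq_zero_iff] at h2
  subst h2
  exact h h0

theorem mem_ideal_smul_top_pi {R : Type*} [CommRing R] {n : ℕ} {J : Ideal R} {v : Fin n → R} :
    v ∈ J • (⊤ : Submodule R (Fin n → R)) ↔ ∀ a, v a ∈ J := by
  constructor
  · intro h
    induction h using Submodule.smul_induction_on' with
    | smul r hr n hn => exact fun a => J.mul_mem_right _ hr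
    | add x _ y _ hx hy => exact fun a => J.add_mem (hx a) (hy a)
  · intro h
    rw [pi_eq_sum_univ v]
    exact Submodule.sum_mem _ fun a _ => Submodule.smul_mem_smul (h a) trivial

theorem mem_freeGrading {n : ℕ} {deg : Fin n → ℤ} {j : ℤ} {v : Fin n → MvPolynomial σ 𝕜} :
    v ∈ freeGrading 𝕜 σ deg j ↔ ∀ a, v a ∈ polyGrading 𝕜 σ (j - deg a) := by
  simp [freeGrading, Submodule.mem_pi]

/-- The homogeneous component of an element of the graded free module `⨁ a, S(-deg a)`. -/
noncomputable def freeComponent {n : ℕ} (deg : Fin n → ℤ) (j : ℤ) :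
    (Fin n → MvPolynomial σ 𝕜) →ₗ[𝕜] (Fin n → MvPolynomial σ 𝕜) :=
  LinearMap.pi fun a => polyComponent (j - deg a) ∘ₗ LinearMap.proj a

variable {n : ℕ} {deg : Fin n → ℤ}

theorem freeComponent_apply (j : ℤ) (v : Fin n → MvPolynomial σ 𝕜) (a : Fin n) :
    freeComponent deg j v a = polyComponent (j - deg a) (v a) := rfl

theorem freeComponent_mem (j : ℤ) (v : Fin n → MvPolynomial σ 𝕜) :
    freeComponent deg j v ∈ freeGrading 𝕜 σ deg j :=
  mem_freeGrading.mpr fun _ => polyComponent_mem _ _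

theorem freeComponent_of_mem {j : ℤ} {v : Fin n → MvPolynomial σ 𝕜}
    (hv : v ∈ freeGrading 𝕜 σ deg j) : freeComponent deg j v = v :=
  funext fun a => polyComponent_of_mem (mem_freeGrading.mp hv a)

theorem freeComponent_of_mem_ne {i j : ℤ} {v : Fin n → MvPolynomial σ 𝕜}
    (hv : v ∈ freeGrading 𝕜 σ deg j) (hij : i ≠ j) : freeComponent deg i v = 0 :=
  funext fun a => polyComponent_of_mem_ne (mem_freeGrading.mp hv a) (by omega)

theorem exists_freeComponent_eq_zero (deg : Fin n → ℤ) (v : Fin n → MvPolynomial σ 𝕜) :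
    ∃ s : Finset ℤ, ∀ j ∉ s, freeComponent deg j v = 0 := by
  classical
  choose s hs using fun a => exists_polyComponent_eq_zero (v a)
  refine ⟨Finset.univ.biUnion fun a => (s a).image (· + deg a), fun j hj => funext fun a => ?_⟩
  refine hs a _ fun h => hj ?_
  exact Finset.mem_biUnion.mpr ⟨a, Finset.mem_univ _, Finset.mem_image.mpr ⟨_, h, by simp⟩⟩

theorem sum_freeComponent {s : Finset ℤ} {v : Fin n → MvPolynomial σ 𝕜}
    (hs : ∀ j ∉ s, freeComponent deg j v = 0) : ∑ j ∈ s, freeComponent deg j v = v := by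
  classical
  have hs' : ∀ j ∉ s, ∀ a, polyComponent (j - deg a) (v a) = 0 := fun j hj a => congrFun (hs j hj) a
  funext a
  rw [Finset.sum_apply]
  simp_rw [freeComponent_apply]
  rw [← Finset.sum_image (s := s) (g := fun j => j - deg a) (f := fun i => polyComponent i (v a))
    (by intro x _ y _ h; simpa using h)]
  refine sum_polyComponent fun j hj => ?_
  have := hs' (j + deg a) (fun h => hj (Finset.mem_image.mpr ⟨_, h, by simp⟩)) a
  simpa using this

/-- Decompose `v`: the image of its degree `i` part has degree `i`, so only `i = j` survives. Hence
kernels of homogeneous maps are graded. -/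
theorem map_freeComponent {n' : ℕ} {deg' : Fin n' → ℤ}
    (f : (Fin n → MvPolynomial σ 𝕜) →ₗ[MvPolynomial σ 𝕜] (Fin n' → MvPolynomial σ 𝕜))
    (hf : ∀ j, ∀ v ∈ freeGrading 𝕜 σ deg j, f v ∈ freeGrading 𝕜 σ deg' j) (j : ℤ)
    (v : Fin n → MvPolynomial σ 𝕜) : f (freeComponent deg j v) = freeComponent deg' j (f v) := by
  classical
  obtain ⟨s, hs⟩ := exists_freeComponent_eq_zero deg v
  conv_rhs => rw [← sum_freeComponent hs, map_sum, map_sum]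
  rw [Finset.sum_eq_single j]
  · exact (freeComponent_of_mem (hf _ _ (freeComponent_mem _ _))).symm
  · intro i _ hij
    exact freeComponent_of_mem_ne (hf _ _ (freeComponent_mem _ _)) hij.symm
  · intro hj
    simp [hs j hj]

theorem smul_mem_freeGrading {i j : ℤ} {p : MvPolynomial σ 𝕜} {v : Fin n → MvPolynomial σ 𝕜}
    (hp : p ∈ polyGrading 𝕜 σ i) (hv : v ∈ freeGrading 𝕜 σ deg j) :
    p • v ∈ freeGrading 𝕜 σ deg (i + j) := by
  rw [mem_freeGrading] at *
  intro a
  have := mul_mem_polyGrading hp (hv a)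
  rwa [← add_sub_assoc] at this

theorem single_mem_freeGrading (deg : Fin n → ℤ) (a : Fin n) :
    (Pi.single a 1 : Fin n → MvPolynomial σ 𝕜) ∈ freeGrading 𝕜 σ deg (deg a) := by
  classical
  rw [mem_freeGrading]
  intro b
  by_cases h : b = a
  · subst h
    simpa using C_mem_polyGrading (σ := σ) (1 : 𝕜)
  · simp [Pi.single_eq_of_ne h]

/-- A linear map out of a graded free module is homogeneous if it is so on the basis. -/
theorem constr_mem_freeGrading {n' : ℕ} {deg' : Fin n' → ℤ}
    {u : Fin n' → Fin n → MvPolynomial σ 𝕜} (hu : ∀ b, u b ∈ freeGrading 𝕜 σ deg (deg' b)) {j : ℤ}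
    {v : Fin n' → MvPolynomial σ 𝕜} (hv : v ∈ freeGrading 𝕜 σ deg' j) :
    Fintype.linearCombination (MvPolynomial σ 𝕜) u v ∈ freeGrading 𝕜 σ deg j := by
  rw [Fintype.linearCombination_apply]
  refine Submodule.sum_mem _ fun b _ => ?_
  have := smul_mem_freeGrading (mem_freeGrading.mp hv b) (hu b)
  rwa [sub_add_cancel] at this

end GradedPieces

/-! ### Uniqueness of minimal graded free resolutions. -/

section Uniqueness

variable {𝕜 σ : Type*} [Field 𝕜]

/-- The homogeneous pieces of a graded module are independent. -/
def IsIndependentGrading {M : Type*} [AddCommGroup M] [Module 𝕜 M] (𝓜 : ℤ → Submodule 𝕜 M) :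
    Prop :=
  ∀ (s : Finset ℤ) (f : ℤ → M), (∀ j ∈ s, f j ∈ 𝓜 j) → ∑ j ∈ s, f j = 0 → ∀ j ∈ s, f j = 0

theorem isIndependentGrading_freeGrading {n : ℕ} (deg : Fin n → ℤ) :
    IsIndependentGrading (freeGrading 𝕜 σ deg) := by
  intro s f hf h0 i hi
  have := congrArg (freeComponent deg i) h0
  rw [map_sum, map_zero, Finset.sum_eq_single_of_mem i hi fun j hj hji =>
    freeComponent_of_mem_ne (hf j hj) hji.symm, freeComponent_of_mem (hf i hi)] at this
  exact this

theorem IsIndependentGrading.comap {M N : Type*} [AddCommGroup M] [Module 𝕜 M] [AddCommGroup N]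
    [Module 𝕜 N] {𝓜 : ℤ → Submodule 𝕜 M} (h : IsIndependentGrading 𝓜) (f : N →ₗ[𝕜] M)
    (hf : Function.Injective f) : IsIndependentGrading fun j => (𝓜 j).comap f := by
  intro s g hg h0 j hj
  refine hf ?_
  rw [map_zero]
  exact h s (fun j => f (g j)) hg (by rw [← map_sum, h0, map_zero]) j hj

section Cover

variable {n n' : ℕ} {deg : Fin n → ℤ} {deg' : Fin n' → ℤ}
  {M : Type*} [AddCommGroup M] [Module 𝕜 M] [Module (MvPolynomial σ 𝕜) M] {𝓜 : ℤ → Submodule 𝕜 M}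

theorem exists_mem_freeGrading_map_eq (h𝓜 : IsIndependentGrading 𝓜)
    {aug : (Fin n → MvPolynomial σ 𝕜) →ₗ[MvPolynomial σ 𝕜] M}
    (haug : ∀ j, ∀ v ∈ freeGrading 𝕜 σ deg j, aug v ∈ 𝓜 j) (hs : Function.Surjective aug)
    {j : ℤ} {m : M} (hm : m ∈ 𝓜 j) : ∃ v ∈ freeGrading 𝕜 σ deg j, aug v = m := by
  classical
  obtain ⟨v, rfl⟩ := hs m
  refine ⟨freeComponent deg j v, freeComponent_mem _ _, ?_⟩
  obtain ⟨s, hs⟩ := exists_freeComponent_eq_zero deg v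
  -- The images of the components, with `aug v` subtracted in degree `j`, sum to zero. Independence
  -- makes the degree `j` term vanish; `insert` covers the case that `j` is not in `s`.
  have h := h𝓜 (insert j s) (fun i => aug (freeComponent deg i v) - if i = j then aug v else 0)
    (fun i _ => by
      refine Submodule.sub_mem _ (haug _ _ (freeComponent_mem _ _)) ?_
      split_ifs with h
      · rwa [h]
      · exact Submodule.zero_mem _)
    (by
      rw [Finset.sum_sub_distrib, ← map_sum, sum_freeComponent, Finset.sum_ite_eq',
        if_pos (Finset.mem_insert_self _ _), sub_self]
      exact fun i hi => hs i fun h => hi (Finset.mem_insert_of_mem h))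
    j (Finset.mem_insert_self _ _)
  rwa [if_pos rfl, sub_eq_zero] at h

theorem exists_homogeneous_lift (h𝓜 : IsIndependentGrading 𝓜)
    {aug : (Fin n → MvPolynomial σ 𝕜) →ₗ[MvPolynomial σ 𝕜] M}
    (haug : ∀ j, ∀ v ∈ freeGrading 𝕜 σ deg j, aug v ∈ 𝓜 j) (hs : Function.Surjective aug)
    {f : (Fin n' → MvPolynomial σ 𝕜) →ₗ[MvPolynomial σ 𝕜] M}
    (hf : ∀ j, ∀ v ∈ freeGrading 𝕜 σ deg' j, f v ∈ 𝓜 j) :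
    ∃ φ : (Fin n' → MvPolynomial σ 𝕜) →ₗ[MvPolynomial σ 𝕜] (Fin n → MvPolynomial σ 𝕜),
      (∀ j, ∀ v ∈ freeGrading 𝕜 σ deg' j, φ v ∈ freeGrading 𝕜 σ deg j) ∧
        ∀ v, aug (φ v) = f v := by
  classical
  choose u hu hu' using fun b =>
    exists_mem_freeGrading_map_eq h𝓜 haug hs (hf _ _ (single_mem_freeGrading deg' b))
  refine ⟨Fintype.linearCombination _ u, fun j v hv => constr_mem_freeGrading hu hv, fun v => ?_⟩
  have : aug ∘ₗ Fintype.linearCombination _ u = f := by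
    refine LinearMap.pi_ext' fun b => LinearMap.ext_ring ?_
    simp [Fintype.linearCombination_apply_single, hu']
  exact LinearMap.congr_fun this v

/-- A homogeneous endomorphism of a graded free module which vanishes modulo the variables is
nilpotent. -/
theorem isNilpotent_of_homogeneous_of_range_le
    {ν : (Fin n → MvPolynomial σ 𝕜) →ₗ[MvPolynomial σ 𝕜] (Fin n → MvPolynomial σ 𝕜)}
    (hν : ∀ j, ∀ v ∈ freeGrading 𝕜 σ deg j, ν v ∈ freeGrading 𝕜 σ deg j)
    (hm : ∀ v a, constantCoeff (ν v a) = 0) : IsNilpotent ν := by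
  classical
  obtain ⟨c, hc⟩ := (Set.finite_range deg).bddAbove
  obtain ⟨b, hb⟩ := (Set.finite_range deg).bddBelow
  -- The coordinate `a` of `ν` on the `i`-th basis vector has degree `deg i - deg a` and no constant
  -- term, so it vanishes unless `deg a < deg i`. Each application thus lowers the bound on the
  -- degrees of the occurring basis vectors by one.
  have key : ∀ (c : ℤ) (v : Fin n → MvPolynomial σ 𝕜), (∀ a, c < deg a → v a = 0) →
      ∀ a, c - 1 < deg a → ν v a = 0 := by
    intro c v hv a ha
    rw [pi_eq_sum_univ' v, map_sum, Finset.sum_apply]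
    refine Finset.sum_eq_zero fun i _ => ?_
    rw [map_smul, Pi.smul_apply]
    by_cases hi : c < deg i
    · simp [hv i hi]
    · have h1 := mem_freeGrading.mp (hν _ _ (single_mem_freeGrading (𝕜 := 𝕜) (σ := σ) deg i)) a
      have h2 := eq_zero_of_mem_polyGrading h1 (by omega) (hm _ _)
      rw [h2, smul_zero]
  have iter : ∀ (k : ℕ) (v : Fin n → MvPolynomial σ 𝕜) (a : Fin n), c - k < deg a →
      (ν ^ k) v a = 0 := by
    intro k
    induction k with
    | zero =>
      intro v a ha
      have := hc (Set.mem_range_self a)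
      simp at ha
      omega
    | succ k ih =>
      intro v a ha
      rw [pow_succ', Module.End.mul_apply]
      exact key (c - k) _ (fun a ha => ih v a ha) a (by push_cast at ha; omega)
  refine ⟨(c - b + 1).toNat, LinearMap.ext fun v => funext fun a => iter _ v a ?_⟩
  have := hb (Set.mem_range_self a)
  omega

/-- Graded Nakayama: `θ` is the identity plus a nilpotent map. -/
theorem bijective_of_homogeneous_of_sub_self
    {θ : (Fin n → MvPolynomial σ 𝕜) →ₗ[MvPolynomial σ 𝕜] (Fin n → MvPolynomial σ 𝕜)}
    (hθ : ∀ j, ∀ v ∈ freeGrading 𝕜 σ deg j, θ v ∈ freeGrading 𝕜 σ deg j)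
    (hm : ∀ v a, constantCoeff ((θ v - v) a) = 0) : Function.Bijective θ := by
  have h : IsNilpotent (θ - 1) := isNilpotent_of_homogeneous_of_range_le (deg := deg)
    (fun j v hv => Submodule.sub_mem _ (hθ j v hv) hv) hm
  have h2 := h.isUnit_add_one
  rw [sub_add_cancel] at h2
  exact (Module.End.isUnit_iff _).mp h2

/-- Modulo the variables, `ψ ∘ φ` is the identity, and homogeneity kills scalar entries between
basis vectors of different degrees. So the degree `j` block of `φ` has a left inverse over `𝕜`,
hence is injective. -/
theorem card_le_of_homogeneous_of_sub_self
    {φ : (Fin n → MvPolynomial σ 𝕜) →ₗ[MvPolynomial σ 𝕜] (Fin n' → MvPolynomial σ 𝕜)}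
    {ψ : (Fin n' → MvPolynomial σ 𝕜) →ₗ[MvPolynomial σ 𝕜] (Fin n → MvPolynomial σ 𝕜)}
    (hφ : ∀ j, ∀ v ∈ freeGrading 𝕜 σ deg j, φ v ∈ freeGrading 𝕜 σ deg' j)
    (hm : ∀ v a, constantCoeff ((ψ (φ v) - v) a) = 0) (j : ℤ) :
    Fintype.card {a // deg a = j} ≤ Fintype.card {b // deg' b = j} := by
  classical
  let A : Matrix {b // deg' b = j} {a // deg a = j} 𝕜 :=
    fun b a => constantCoeff (φ (Pi.single a.1 1) b.1)
  let B : Matrix {a // deg a = j} {b // deg' b = j} 𝕜 :=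
    fun a b => constantCoeff (ψ (Pi.single b.1 1) a.1)
  have hBA : B * A = 1 := by
    ext a a'
    have h1 := hm (Pi.single a'.1 1) a.1
    have h2 : ψ (φ (Pi.single a'.1 1)) =
        ∑ b, φ (Pi.single a'.1 1) b • ψ (Pi.single b 1) := by
      conv_lhs => rw [pi_eq_sum_univ' (φ (Pi.single a'.1 1)), map_sum]
      refine Finset.sum_congr rfl fun b _ => ?_
      rw [map_smul]
    rw [Pi.sub_apply, map_sub, sub_eq_zero, h2, Finset.sum_apply, map_sum] at h1
    have h3 : ∀ b, deg' b ≠ j → constantCoeff (φ (Pi.single a'.1 1) b) = 0 := by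
      intro b hb
      refine constantCoeff_eq_zero_of_mem_polyGrading
        (mem_freeGrading.mp (hφ _ _ (single_mem_freeGrading deg a'.1)) b) ?_
      rw [a'.2]
      exact fun h => hb (by omega)
    rw [Matrix.mul_apply]
    trans ∑ b, constantCoeff ((φ (Pi.single a'.1 1) b • ψ (Pi.single b 1)) a.1)
    · rw [← Fintype.sum_subtype_add_sum_subtype (fun b => deg' b = j)]
      rw [Finset.sum_eq_zero (s := (Finset.univ : Finset {b // ¬ deg' b = j})), add_zero]
      · refine Finset.sum_congr rfl fun b _ => ?_
        rw [Pi.smul_apply, smul_eq_mul, map_mul, mul_comm]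
      · intro b _
        rw [Pi.smul_apply, smul_eq_mul, map_mul, h3 b.1 b.2, zero_mul]
    · rw [h1, Matrix.one_apply]
      by_cases h : a = a'
      · subst h
        simp
      · rw [if_neg h, Pi.single_eq_of_ne fun h' => h (Subtype.ext h'), map_zero]
  refine card_le_of_injective 𝕜 A.mulVecLin ?_
  intro u v huv
  have := congrArg B.mulVec huv
  simpa [Matrix.mulVec_mulVec, hBA] using this

end Cover

/-- Minimal graded covers are unique up to a homogeneous isomorphism. -/
theorem exists_equiv_of_minimal_covers {n n' : ℕ} {deg : Fin n → ℤ} {deg' : Fin n' → ℤ}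
    {M M' : Type*} [AddCommGroup M] [Module 𝕜 M] [Module (MvPolynomial σ 𝕜) M]
    [AddCommGroup M'] [Module 𝕜 M'] [Module (MvPolynomial σ 𝕜) M']
    {𝓜 : ℤ → Submodule 𝕜 M} {𝓜' : ℤ → Submodule 𝕜 M'}
    (h𝓜 : IsIndependentGrading 𝓜) (h𝓜' : IsIndependentGrading 𝓜')
    (e : M ≃ₗ[MvPolynomial σ 𝕜] M') (he : ∀ j m, m ∈ 𝓜 j ↔ e m ∈ 𝓜' j)
    {aug : (Fin n → MvPolynomial σ 𝕜) →ₗ[MvPolynomial σ 𝕜] M}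
    (haug : ∀ j, ∀ v ∈ freeGrading 𝕜 σ deg j, aug v ∈ 𝓜 j) (hs : Function.Surjective aug)
    (hmin : ∀ v, aug v = 0 → ∀ a, constantCoeff (v a) = 0)
    {aug' : (Fin n' → MvPolynomial σ 𝕜) →ₗ[MvPolynomial σ 𝕜] M'}
    (haug' : ∀ j, ∀ v ∈ freeGrading 𝕜 σ deg' j, aug' v ∈ 𝓜' j) (hs' : Function.Surjective aug')
    (hmin' : ∀ v, aug' v = 0 → ∀ a, constantCoeff (v a) = 0) :
    (∀ j, Fintype.card {a // deg a = j} = Fintype.card {b // deg' b = j}) ∧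
      ∃ φ : (Fin n → MvPolynomial σ 𝕜) ≃ₗ[MvPolynomial σ 𝕜] (Fin n' → MvPolynomial σ 𝕜),
        (∀ v, aug' (φ v) = e (aug v)) ∧
          ∀ j v, v ∈ freeGrading 𝕜 σ deg j ↔ φ v ∈ freeGrading 𝕜 σ deg' j := by
  obtain ⟨φ, hφ, hφe⟩ := exists_homogeneous_lift (deg' := deg) h𝓜' haug' hs'
    (f := e.toLinearMap ∘ₗ aug) fun j v hv => (he _ _).mp (haug j v hv)
  obtain ⟨ψ, hψ, hψe⟩ := exists_homogeneous_lift (deg' := deg') h𝓜 haug hs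
    (f := e.symm.toLinearMap ∘ₗ aug') fun j v hv => (he _ _).mpr (by simpa using haug' j v hv)
  -- `ψ (φ v) - v` is in the kernel of `aug`, which minimality puts inside `𝔪 F`.
  have hψφ : ∀ v a, constantCoeff ((ψ (φ v) - v) a) = 0 := fun v => hmin _ (by
    rw [map_sub, hψe, LinearMap.comp_apply, hφe]
    simp)
  have hφψ : ∀ v a, constantCoeff ((φ (ψ v) - v) a) = 0 := fun v => hmin' _ (by
    rw [map_sub, hφe, LinearMap.comp_apply, hψe]
    simp)
  have b1 : Function.Bijective (ψ ∘ₗ φ) := bijective_of_homogeneous_of_sub_self (deg := deg)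
    (fun j v hv => hψ _ _ (hφ _ _ hv)) hψφ
  have b2 : Function.Bijective (φ ∘ₗ ψ) := bijective_of_homogeneous_of_sub_self (deg := deg')
    (fun j v hv => hφ _ _ (hψ _ _ hv)) hφψ
  have hb : Function.Bijective φ :=
    ⟨Function.Injective.of_comp (f := ψ) b1.1, Function.Surjective.of_comp (g := ψ) b2.2⟩
  refine ⟨fun j => le_antisymm (card_le_of_homogeneous_of_sub_self hφ hψφ j)
    (card_le_of_homogeneous_of_sub_self hψ hφψ j), LinearEquiv.ofBijective φ hb, hφe,
    fun j v => ⟨hφ j v, fun hv => ?_⟩⟩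
  -- `φ` commutes with components and is injective, so it also reflects degrees.
  have : freeComponent deg j v = v := hb.1 (by
    rw [map_freeComponent φ hφ]
    exact freeComponent_of_mem hv)
  rw [← this]
  exact freeComponent_mem _ _

namespace MinimalGradedFreeResolution

variable {M : Type*} [AddCommGroup M] [Module 𝕜 M] [Module (MvPolynomial σ 𝕜) M]
  {𝓜 : ℤ → Submodule 𝕜 M}

theorem constantCoeff_eq_zero_of_mem_range (F : MinimalGradedFreeResolution (σ := σ) 𝓜) {i : ℕ}
    {v : Fin (F.rank i) → MvPolynomial σ 𝕜} (hv : v ∈ LinearMap.range (F.d i))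
    (a : Fin (F.rank i)) : constantCoeff (v a) = 0 :=
  mem_span_range_X.mp (mem_ideal_smul_top_pi.mp (F.minimal i hv) a)

/-- The grading of the first syzygy module of a graded free resolution. -/
noncomputable def syzygyGrading (F : MinimalGradedFreeResolution (σ := σ) 𝓜) (j : ℤ) :
    Submodule 𝕜 (LinearMap.ker F.aug) :=
  (freeGrading 𝕜 σ (F.deg 0) j).comap ((LinearMap.ker F.aug).subtype.restrictScalars 𝕜)

/-- Truncating a minimal graded free resolution yields one of the first syzygy module. -/
noncomputable def tail (F : MinimalGradedFreeResolution (σ := σ) 𝓜) :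
    MinimalGradedFreeResolution (σ := σ) F.syzygyGrading where
  rank i := F.rank (i + 1)
  deg i := F.deg (i + 1)
  d i := F.d (i + 1)
  aug := (F.d 0).codRestrict _ fun v => F.exact_zero.apply_apply_eq_zero v
  d_homogeneous i := F.d_homogeneous (i + 1)
  aug_homogeneous j v hv := F.d_homogeneous 0 j v hv
  aug_surjective := by
    rintro ⟨v, hv⟩
    obtain ⟨w, rfl⟩ := (F.exact_zero v).mp hv
    exact ⟨w, rfl⟩
  exact_zero v := by
    rw [← F.exact_succ 0 v]
    exact Subtype.ext_iff
  exact_succ i := F.exact_succ (i + 1)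
  minimal i := F.minimal (i + 1)

end MinimalGradedFreeResolution

/-- Isomorphic graded modules have the same graded Betti numbers. -/
theorem MinimalGradedFreeResolution.betti_eq_of_equiv.{u, v} {𝕜 : Type u} {σ : Type v} [Field 𝕜]
    (i : ℕ) (j : ℤ) : ∀ {M M' : Type (max v u)} [AddCommGroup M] [Module 𝕜 M]
    [Module (MvPolynomial σ 𝕜) M] [AddCommGroup M'] [Module 𝕜 M'] [Module (MvPolynomial σ 𝕜) M']
    {𝓜 : ℤ → Submodule 𝕜 M} {𝓜' : ℤ → Submodule 𝕜 M'}
    (_ : IsIndependentGrading 𝓜) (_ : IsIndependentGrading 𝓜')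
    (e : M ≃ₗ[MvPolynomial σ 𝕜] M') (_ : ∀ j m, m ∈ 𝓜 j ↔ e m ∈ 𝓜' j)
    (F : MinimalGradedFreeResolution (σ := σ) 𝓜) (F' : MinimalGradedFreeResolution (σ := σ) 𝓜'),
    F.betti i j = F'.betti i j := by
  -- The modules vary in the induction because `ih` is applied to first syzygy modules; these lie in
  -- the universe of the polynomial ring, whence the restriction on `M` and `M'`.
  induction i with
  | zero =>
    intro M M' _ _ _ _ _ _ 𝓜 𝓜' h𝓜 h𝓜' e he F F'
    exact (exists_equiv_of_minimal_covers h𝓜 h𝓜' e he F.aug_homogeneous F.aug_surjective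
      (fun v hv => F.constantCoeff_eq_zero_of_mem_range ((F.exact_zero v).mp hv))
      F'.aug_homogeneous F'.aug_surjective
      (fun v hv => F'.constantCoeff_eq_zero_of_mem_range ((F'.exact_zero v).mp hv))).1 j
  | succ i ih =>
    intro M M' _ _ _ _ _ _ 𝓜 𝓜' h𝓜 h𝓜' e he F F'
    obtain ⟨-, φ, hφ, hφg⟩ := exists_equiv_of_minimal_covers h𝓜 h𝓜' e he F.aug_homogeneous
      F.aug_surjective
      (fun v hv => F.constantCoeff_eq_zero_of_mem_range ((F.exact_zero v).mp hv))
      F'.aug_homogeneous F'.aug_surjective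
      (fun v hv => F'.constantCoeff_eq_zero_of_mem_range ((F'.exact_zero v).mp hv))
    -- The isomorphism of covers lies over `e`, so it restricts to a graded isomorphism of first
    -- syzygy modules.
    have hK : (LinearMap.ker F.aug).map φ.toLinearMap = LinearMap.ker F'.aug := by
      ext w
      obtain ⟨v, rfl⟩ := φ.surjective w
      simp [hφ]
    exact ih (𝓜 := F.syzygyGrading) (𝓜' := F'.syzygyGrading)
      ((isIndependentGrading_freeGrading _).comap _ Subtype.val_injective)
      ((isIndependentGrading_freeGrading _).comap _ Subtype.val_injective)
      (φ.ofSubmodules _ _ hK) (fun j m => hφg j m.1) F.tail F'.tail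

theorem isIndependentGrading_quotGrading {I : Ideal (MvPolynomial σ 𝕜)}
    (hI : ∀ p ∈ I, ∀ j, polyComponent j p ∈ I) : IsIndependentGrading (quotGrading I) := by
  intro s f hf h0 j hj
  choose! p hp hpf using hf
  have h1 : ∑ j ∈ s, p j ∈ I := by
    rw [← Ideal.Quotient.eq_zero_iff_mem, map_sum, ← h0]
    exact Finset.sum_congr rfl hpf
  have h2 := hI _ h1 j
  rw [map_sum, Finset.sum_eq_single_of_mem j hj fun i hi hij =>
    polyComponent_of_mem_ne (hp i hi) hij.symm, polyComponent_of_mem (hp j hj)] at h2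
  rw [← hpf j hj]
  exact Ideal.Quotient.eq_zero_iff_mem.mpr h2

end Uniqueness

/-! ### Existence of minimal graded free resolutions. -/

section Existence

variable {𝕜 σ : Type*} [Field 𝕜]

section

variable {n : ℕ} {deg : Fin n → ℤ} {K : Submodule (MvPolynomial σ 𝕜) (Fin n → MvPolynomial σ 𝕜)}

/-- By noetherianity there are finitely many generators; their homogeneous components lie in `K` and
generate it too. -/
theorem exists_homogeneous_generators [Finite σ]
    (hK : ∀ v ∈ K, ∀ j, freeComponent deg j v ∈ K) :
    ∃ (m : ℕ) (deg' : Fin m → ℤ) (u : Fin m → Fin n → MvPolynomial σ 𝕜),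
      (∀ b, u b ∈ freeGrading 𝕜 σ deg (deg' b)) ∧
        Submodule.span (MvPolynomial σ 𝕜) (Set.range u) = K := by
  classical
  obtain ⟨T, hT⟩ := IsNoetherian.noetherian K
  choose s hs using exists_freeComponent_eq_zero (𝕜 := 𝕜) (σ := σ) deg
  let U := T.biUnion fun v => (s v).image fun j => freeComponent deg j v
  have hU : ∀ u ∈ U, ∃ j, u ∈ freeGrading 𝕜 σ deg j := by
    intro u hu
    obtain ⟨v, -, h⟩ := Finset.mem_biUnion.mp hu
    obtain ⟨j, -, rfl⟩ := Finset.mem_image.mp h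
    exact ⟨j, freeComponent_mem _ _⟩
  have hspan : Submodule.span (MvPolynomial σ 𝕜) (U : Set (Fin n → MvPolynomial σ 𝕜)) = K := by
    apply le_antisymm
    · rw [Submodule.span_le]
      intro u hu
      obtain ⟨v, hv, h⟩ := Finset.mem_biUnion.mp hu
      obtain ⟨j, -, rfl⟩ := Finset.mem_image.mp h
      exact hK v (hT ▸ Submodule.subset_span hv) j
    · rw [← hT, Submodule.span_le]
      intro v hv
      rw [← sum_freeComponent (hs v)]
      exact Submodule.sum_mem _ fun j hj => Submodule.subset_span
        (Finset.mem_biUnion.mpr ⟨v, hv, Finset.mem_image_of_mem _ hj⟩)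
  obtain ⟨m, u, -, hu⟩ := U.finite_toSet.fin_param
  have hu' : ∀ b, u b ∈ U := fun b => by
    have : u b ∈ (U : Set _) := hu ▸ Set.mem_range_self b
    exact this
  choose deg' hdeg' using fun b => hU _ (hu' b)
  exact ⟨m, deg', u, hdeg', by rw [hu, hspan]⟩

theorem constantCoeff_eq_zero_of_minimal_generators {m : ℕ} {deg' : Fin m → ℤ}
    {u : Fin m → Fin n → MvPolynomial σ 𝕜} (hu : ∀ b, u b ∈ freeGrading 𝕜 σ deg (deg' b))
    (hmin : ∀ (l : ℕ) (deg'' : Fin l → ℤ) (t : Fin l → Fin n → MvPolynomial σ 𝕜),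
      (∀ b, t b ∈ freeGrading 𝕜 σ deg (deg'' b)) →
        Submodule.span (MvPolynomial σ 𝕜) (Set.range t) =
          Submodule.span (MvPolynomial σ 𝕜) (Set.range u) → m ≤ l)
    {w : Fin m → MvPolynomial σ 𝕜}
    (hw : Fintype.linearCombination (MvPolynomial σ 𝕜) u w = 0) (a : Fin m) :
    constantCoeff (w a) = 0 := by
  by_contra hc
  obtain ⟨l, rfl⟩ : ∃ l, m = l + 1 := ⟨m - 1, by have := a.2; omega⟩
  -- In the degree `deg' a` part of the relation, the coefficient of `u a` is a nonzero scalar. So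
  -- `u a` is redundant, against minimality of the number of generators.
  have h1 := map_freeComponent (Fintype.linearCombination (MvPolynomial σ 𝕜) u)
    (fun j v hv => constr_mem_freeGrading hu hv) (deg' a) w
  rw [hw, map_zero, Fintype.linearCombination_apply, Fin.sum_univ_succAbove _ a,
    freeComponent_apply, sub_self] at h1
  have h2 : polyComponent 0 (w a) = C (constantCoeff (w a)) := by
    classical
    ext d
    rw [coeff_polyComponent, coeff_C]
    by_cases hd : d = 0
    · subst hd
      simp [constantCoeff_eq]
    · rw [if_neg (Ne.symm hd), if_neg]
      simpa [Finsupp.degree_eq_zero_iff] using hd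
  rw [h2] at h1
  have h3 : u a ∈ Submodule.span (MvPolynomial σ 𝕜) (Set.range (u ∘ a.succAbove)) := by
    have h4 : (C (constantCoeff (w a)) : MvPolynomial σ 𝕜) • u a ∈
        Submodule.span (MvPolynomial σ 𝕜) (Set.range (u ∘ a.succAbove)) := by
      rw [eq_neg_of_add_eq_zero_left h1]
      exact Submodule.neg_mem _ (Submodule.sum_mem _ fun b _ =>
        Submodule.smul_mem _ _ (Submodule.subset_span ⟨b, rfl⟩))
    have h5 := Submodule.smul_mem _ (C (constantCoeff (w a))⁻¹ : MvPolynomial σ 𝕜) h4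
    rwa [smul_smul, ← C_mul, inv_mul_cancel₀ hc, C_1, one_smul] at h5
  have h6 := hmin l (deg' ∘ a.succAbove) (u ∘ a.succAbove) (fun b => hu _) (by
    apply le_antisymm
    · exact Submodule.span_mono (Set.range_comp_subset_range _ _)
    · rw [Submodule.span_le]
      rintro _ ⟨b, rfl⟩
      by_cases hb : b = a
      · rw [hb]
        exact h3
      · obtain ⟨c, rfl⟩ := Fin.exists_succAbove_eq hb
        exact Submodule.subset_span ⟨c, rfl⟩)
  omega

end

/-- A graded submodule, contained in `𝔪 F`, of a graded free module `F = ⨁ a, S(-deg a)`. -/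
structure MinimalSyzygyModule (𝕜 σ : Type*) [Field 𝕜] where
  rank : ℕ
  deg : Fin rank → ℤ
  toSubmodule : Submodule (MvPolynomial σ 𝕜) (Fin rank → MvPolynomial σ 𝕜)
  freeComponent_mem : ∀ v ∈ toSubmodule, ∀ j, freeComponent deg j v ∈ toSubmodule
  constantCoeff_eq_zero : ∀ v ∈ toSubmodule, ∀ a, constantCoeff (v a) = 0

namespace MinimalSyzygyModule

theorem exists_minimal_cover [Finite σ] (Z : MinimalSyzygyModule 𝕜 σ) :
    ∃ (Y : MinimalSyzygyModule 𝕜 σ)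
      (d : (Fin Y.rank → MvPolynomial σ 𝕜) →ₗ[MvPolynomial σ 𝕜] (Fin Z.rank → MvPolynomial σ 𝕜)),
      (∀ j, ∀ v ∈ freeGrading 𝕜 σ Y.deg j, d v ∈ freeGrading 𝕜 σ Z.deg j) ∧
        LinearMap.range d = Z.toSubmodule ∧ LinearMap.ker d = Y.toSubmodule := by
  classical
  have hex := exists_homogeneous_generators Z.freeComponent_mem
  obtain ⟨deg', u, hu, hspan⟩ := Nat.find_spec hex
  have hgr : ∀ j, ∀ v ∈ freeGrading 𝕜 σ deg' j,
      Fintype.linearCombination (MvPolynomial σ 𝕜) u v ∈ freeGrading 𝕜 σ Z.deg j :=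
    fun j v hv => constr_mem_freeGrading hu hv
  refine ⟨⟨_, deg', LinearMap.ker (Fintype.linearCombination (MvPolynomial σ 𝕜) u), ?_, ?_⟩,
    Fintype.linearCombination (MvPolynomial σ 𝕜) u, hgr, ?_, rfl⟩
  · intro v hv j
    rw [LinearMap.mem_ker] at hv ⊢
    rw [map_freeComponent _ hgr, hv, map_zero]
  · intro v hv
    exact constantCoeff_eq_zero_of_minimal_generators hu
      (fun l deg'' t ht hts => Nat.find_min' hex ⟨deg'', t, ht, hts.trans hspan⟩) hv
  · rw [Fintype.range_linearCombination, hspan]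

/-- The kernel of a chosen minimal graded free cover. -/
noncomputable def next [Finite σ] (Z : MinimalSyzygyModule 𝕜 σ) : MinimalSyzygyModule 𝕜 σ :=
  Z.exists_minimal_cover.choose

/-- A chosen minimal graded free cover. -/
noncomputable def cover [Finite σ] (Z : MinimalSyzygyModule 𝕜 σ) :
    (Fin Z.next.rank → MvPolynomial σ 𝕜) →ₗ[MvPolynomial σ 𝕜] (Fin Z.rank → MvPolynomial σ 𝕜) :=
  Z.exists_minimal_cover.choose_spec.choose

theorem cover_homogeneous [Finite σ] (Z : MinimalSyzygyModule 𝕜 σ) :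
    ∀ j, ∀ v ∈ freeGrading 𝕜 σ Z.next.deg j, Z.cover v ∈ freeGrading 𝕜 σ Z.deg j :=
  Z.exists_minimal_cover.choose_spec.choose_spec.1

theorem range_cover [Finite σ] (Z : MinimalSyzygyModule 𝕜 σ) :
    LinearMap.range Z.cover = Z.toSubmodule :=
  Z.exists_minimal_cover.choose_spec.choose_spec.2.1

theorem ker_cover [Finite σ] (Z : MinimalSyzygyModule 𝕜 σ) :
    LinearMap.ker Z.cover = Z.next.toSubmodule :=
  Z.exists_minimal_cover.choose_spec.choose_spec.2.2

end MinimalSyzygyModule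

/-- The quotient by a proper homogeneous ideal has a minimal graded free resolution. -/
theorem nonempty_minimalGradedFreeResolution [Finite σ] {I : Ideal (MvPolynomial σ 𝕜)}
    (hI : ∀ p ∈ I, ∀ j, polyComponent j p ∈ I) (hI0 : ∀ p ∈ I, constantCoeff p = 0) :
    Nonempty (MinimalGradedFreeResolution (σ := σ) (quotGrading I)) := by
  let aug : (Fin 1 → MvPolynomial σ 𝕜) →ₗ[MvPolynomial σ 𝕜] (MvPolynomial σ 𝕜 ⧸ I) :=
    I.mkQ ∘ₗ LinearMap.proj 0
  have haug : ∀ v, aug v = 0 ↔ v 0 ∈ I := fun v => Submodule.Quotient.mk_eq_zero I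
  -- The first syzygy module of `S/I` is `I` itself; `hI0` places it in `𝔪`.
  let Z₀ : MinimalSyzygyModule 𝕜 σ :=
    { rank := 1
      deg := 0
      toSubmodule := LinearMap.ker aug
      freeComponent_mem := fun v hv j => (haug _).mpr (hI _ ((haug v).mp hv) _)
      constantCoeff_eq_zero := fun v hv a => by
        rw [Subsingleton.elim a 0]
        exact hI0 _ ((haug v).mp hv) }
  let Z : ℕ → MinimalSyzygyModule 𝕜 σ := fun i => Nat.rec Z₀ (fun _ Y => Y.next) i
  exact ⟨{
    rank := fun i => (Z i).rank
    deg := fun i => (Z i).deg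
    d := fun i => (Z i).cover
    aug := aug
    d_homogeneous := fun i => (Z i).cover_homogeneous
    aug_homogeneous := fun j v hv =>
      ⟨v 0, by
        have := mem_freeGrading.mp hv 0
        rwa [show (Z 0).deg 0 = 0 from rfl, sub_zero] at this, rfl⟩
    aug_surjective := fun m => by
      obtain ⟨p, rfl⟩ := Ideal.Quotient.mk_surjective m
      exact ⟨fun _ => p, rfl⟩
    exact_zero := LinearMap.exact_iff.mpr (Z 0).range_cover.symm
    exact_succ := fun i =>
      LinearMap.exact_iff.mpr ((Z i).ker_cover.trans (Z (i + 1)).range_cover.symm)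
    minimal := fun i v hv => mem_ideal_smul_top_pi.mpr fun a => mem_span_range_X.mpr
      ((Z i).constantCoeff_eq_zero v ((Z i).range_cover ▸ hv) a) }⟩

end Existence

/-! ### Regular sequences on free modules and on kernels. -/

section RegularSequences

open RingTheory.Sequence

variable {R : Type*} [CommRing R]

theorem mk_mem_smul_top {I P : Ideal R} {f : R} :
    Ideal.Quotient.mk I f ∈ (P • ⊤ : Submodule R (R ⧸ I)) ↔ f ∈ I ⊔ P := by
  have h : (P • ⊤ : Submodule R (R ⧸ I)) = Submodule.map I.mkQ P := by
    conv_rhs => rw [← Ideal.mul_top P, ← smul_eq_mul, Submodule.map_smul'']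
    rw [Submodule.map_top, Submodule.range_mkQ]
  rw [h, ← Submodule.comap_map_mkQ I P]
  rfl

variable {F M : Type*} [AddCommGroup F] [Module R F] [AddCommGroup M] [Module R M] {rs : List R}

theorem RingTheory.Sequence.IsWeaklyRegular.take (h : IsWeaklyRegular M rs) (k : ℕ) :
    IsWeaklyRegular M (rs.take k) := by
  have := List.take_append_drop k rs
  rw [← this, isWeaklyRegular_append_iff] at h
  exact h.1

theorem RingTheory.Sequence.IsWeaklyRegular.pi {n : ℕ} (h : IsWeaklyRegular R rs) :
    IsWeaklyRegular (Fin n → R) rs := by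
  refine ⟨fun i hi => ?_⟩
  rw [isSMulRegular_quotient_iff_mem_of_smul_mem]
  intro v hv
  rw [mem_ideal_smul_top_pi] at hv ⊢
  intro a
  have h1 := (isSMulRegular_quotient_iff_mem_of_smul_mem _ _).mp (h.regular_mod_prev i hi) (v a)
  rw [smul_eq_mul, Ideal.mul_top] at h1
  exact h1 (hv a)

/-- Regularity on `M` keeps `ker g → F` injective modulo each prefix of `rs`, so regularity on `F`
passes to the kernel. -/
theorem RingTheory.Sequence.IsWeaklyRegular.ker {g : F →ₗ[R] M} (hg : Function.Surjective g)
    (hF : IsWeaklyRegular F rs) (hM : IsWeaklyRegular M rs) :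
    IsWeaklyRegular (LinearMap.ker g) rs := by
  refine ⟨fun i hi => ?_⟩
  rw [isSMulRegular_quotient_iff_mem_of_smul_mem]
  intro x hx
  -- The leftmost term is the kernel of an inclusion, hence zero; exactness there is the required
  -- injectivity.
  have hex := map_first_exact_on_four_term_right_exact_of_isSMulRegular_last (rs := rs.take i)
    (f₁ := (LinearMap.ker (LinearMap.ker g).subtype).subtype) (f₂ := (LinearMap.ker g).subtype)
    (f₃ := g) (LinearMap.exact_subtype_ker_map _) (LinearMap.exact_subtype_ker_map _) hg
    (hM.take i)
  have h1 : (x : F) ∈ (Ideal.ofList (rs.take i) • ⊤ : Submodule R F) := by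
    refine (isSMulRegular_quotient_iff_mem_of_smul_mem _ _).mp (hF.regular_mod_prev i hi) _ ?_
    exact Submodule.smul_top_le_comap_smul_top _ (LinearMap.ker g).subtype hx
  obtain ⟨z, hz⟩ := (hex (Submodule.Quotient.mk x)).mp
    ((Submodule.Quotient.mk_eq_zero _).mpr h1)
  obtain ⟨⟨z, hz0⟩, rfl⟩ := Submodule.Quotient.mk_surjective _ z
  have hz0' : z = 0 := Subtype.ext hz0
  subst hz0'
  rw [← Submodule.Quotient.mk_eq_zero, ← hz]
  rfl

end RegularSequences

/-! ### Specialization of resolutions modulo a regular sequence. -/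

section Specialization

open RingTheory.Sequence

variable {𝕜 σ τ : Type*} [Field 𝕜]

section

variable {M : Type*} [AddCommGroup M] [Module 𝕜 M] [Module (MvPolynomial σ 𝕜) M]
  {𝓜 : ℤ → Submodule 𝕜 M} {rs : List (MvPolynomial σ 𝕜)}

/-- Each image is the kernel of a surjection from a free module onto `M` or the preceding image. -/
theorem MinimalGradedFreeResolution.isWeaklyRegular_range
    (F : MinimalGradedFreeResolution (σ := σ) 𝓜) (hS : IsWeaklyRegular (MvPolynomial σ 𝕜) rs)
    (hM : IsWeaklyRegular M rs) (i : ℕ) : IsWeaklyRegular (LinearMap.range (F.d i)) rs := by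
  induction i with
  | zero =>
    rw [← F.exact_zero.linearMap_ker_eq]
    exact IsWeaklyRegular.ker F.aug_surjective hS.pi hM
  | succ i ih =>
    rw [← (F.exact_succ i).linearMap_ker_eq, ← LinearMap.ker_rangeRestrict]
    exact IsWeaklyRegular.ker (LinearMap.surjective_rangeRestrict _) hS.pi ih

theorem exists_sub_mem_smul_top {N₁ N₂ N₃ N₄ : Type*} [AddCommGroup N₁] [AddCommGroup N₂]
    [AddCommGroup N₃] [AddCommGroup N₄] {R : Type*} [CommRing R] [Module R N₁] [Module R N₂]
    [Module R N₃] [Module R N₄] {rs : List R} {f₁ : N₁ →ₗ[R] N₂} {f₂ : N₂ →ₗ[R] N₃}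
    {f₃ : N₃ →ₗ[R] N₄} (h₁₂ : Function.Exact f₁ f₂) (h₂₃ : Function.Exact f₂ f₃)
    (h₃ : Function.Surjective f₃) (h₄ : IsWeaklyRegular N₄ rs) {v : N₂}
    (hv : f₂ v ∈ (Ideal.ofList rs • ⊤ : Submodule R N₃)) :
    ∃ w, f₁ w - v ∈ (Ideal.ofList rs • ⊤ : Submodule R N₂) := by
  obtain ⟨w, hw⟩ := (map_first_exact_on_four_term_right_exact_of_isSMulRegular_last h₁₂ h₂₃ h₃ h₄
    (Submodule.Quotient.mk v)).mp ((Submodule.Quotient.mk_eq_zero _).mpr hv)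
  obtain ⟨w, rfl⟩ := Submodule.Quotient.mk_surjective _ w
  exact ⟨w, (Submodule.Quotient.eq _).mp hw⟩

end

theorem rename_mem_polyGrading (g : σ → τ) {j : ℤ} {p : MvPolynomial σ 𝕜}
    (hp : p ∈ polyGrading 𝕜 σ j) : rename g p ∈ polyGrading 𝕜 τ j := by
  cases j with
  | ofNat n => exact IsHomogeneous.rename_isHomogeneous hp
  | negSucc n =>
    rw [show p = 0 from hp, map_zero]
    exact Submodule.zero_mem _

theorem rename_comp_mem_freeGrading (g : σ → τ) {n : ℕ} {deg : Fin n → ℤ} {j : ℤ}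
    {v : Fin n → MvPolynomial σ 𝕜} (hv : v ∈ freeGrading 𝕜 σ deg j) :
    (fun a => rename g (v a)) ∈ freeGrading 𝕜 τ deg j :=
  mem_freeGrading.mpr fun a => rename_mem_polyGrading g (mem_freeGrading.mp hv a)

theorem exists_lift_freeGrading {g : σ → τ} (hg : Function.Surjective g) {n : ℕ}
    {deg : Fin n → ℤ} {j : ℤ} {v : Fin n → MvPolynomial τ 𝕜} (hv : v ∈ freeGrading 𝕜 τ deg j) :
    ∃ w ∈ freeGrading 𝕜 σ deg j, (fun a => rename g (w a)) = v := by
  refine ⟨_, rename_comp_mem_freeGrading (Function.surjInv hg) hv, funext fun a => ?_⟩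
  rw [rename_rename, (Function.rightInverse_surjInv hg).comp_eq_id, rename_id_apply]

theorem exists_lift_pi {g : σ → τ} (hg : Function.Surjective g) {n : ℕ}
    (v : Fin n → MvPolynomial τ 𝕜) :
    ∃ w : Fin n → MvPolynomial σ 𝕜, (fun a => rename g (w a)) = v := by
  choose w hw using fun a => rename_surjective (R := 𝕜) g hg (v a)
  exact ⟨w, funext hw⟩

/-- Extension of scalars along `rename g` of a linear map out of a finite free module. -/
noncomputable def renameExtend {n : ℕ} {M N : Type*} [AddCommGroup M]
    [Module (MvPolynomial σ 𝕜) M] [AddCommGroup N] [Module (MvPolynomial τ 𝕜) N]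
    (q : M →+ N) (f : (Fin n → MvPolynomial σ 𝕜) →ₗ[MvPolynomial σ 𝕜] M) :
    (Fin n → MvPolynomial τ 𝕜) →ₗ[MvPolynomial τ 𝕜] N :=
  Fintype.linearCombination _ fun b => q (f (Pi.single b 1))

theorem renameExtend_rename (g : σ → τ) {n : ℕ} {M N : Type*} [AddCommGroup M]
    [Module (MvPolynomial σ 𝕜) M] [AddCommGroup N] [Module (MvPolynomial τ 𝕜) N]
    {q : M →+ N} (hq : ∀ (p : MvPolynomial σ 𝕜) m, q (p • m) = rename g p • q m)
    (f : (Fin n → MvPolynomial σ 𝕜) →ₗ[MvPolynomial σ 𝕜] M) (v : Fin n → MvPolynomial σ 𝕜) :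
    renameExtend q f (fun a => rename g (v a)) = q (f v) := by
  conv_rhs => rw [pi_eq_sum_univ' v, map_sum, map_sum]
  rw [renameExtend, Fintype.linearCombination_apply]
  exact Finset.sum_congr rfl fun b _ => by rw [map_smul, hq]

/-- Specializing a minimal graded free resolution of `S/I` along an identification of variables,
provided that the kernel is generated by a sequence which is regular on `S` and on `S/I`. -/
theorem exists_specialized_resolution {g : σ → τ} (hg : Function.Surjective g)
    {I : Ideal (MvPolynomial σ 𝕜)} {J : Ideal (MvPolynomial τ 𝕜)}
    (hJ : I.map (rename g : MvPolynomial σ 𝕜 →ₐ[𝕜] MvPolynomial τ 𝕜) = J)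
    {rs : List (MvPolynomial σ 𝕜)}
    (hrs : Ideal.ofList rs =
      RingHom.ker (rename g : MvPolynomial σ 𝕜 →ₐ[𝕜] MvPolynomial τ 𝕜))
    (hS : IsWeaklyRegular (MvPolynomial σ 𝕜) rs)
    (hI : IsWeaklyRegular (MvPolynomial σ 𝕜 ⧸ I) rs)
    (F : MinimalGradedFreeResolution (σ := σ) (quotGrading I)) :
    ∃ F' : MinimalGradedFreeResolution (σ := τ) (quotGrading J),
      ∀ i j, F'.betti i j = F.betti i j := by
  have hIJ : I ≤ J.comap (rename g : MvPolynomial σ 𝕜 →ₐ[𝕜] MvPolynomial τ 𝕜) :=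
    Ideal.map_le_iff_le_comap.mp hJ.le
  let q : (MvPolynomial σ 𝕜 ⧸ I) →+* (MvPolynomial τ 𝕜 ⧸ J) :=
    Ideal.quotientMap J (rename g : MvPolynomial σ 𝕜 →ₐ[𝕜] MvPolynomial τ 𝕜).toRingHom hIJ
  have hqmk : ∀ p, q (Ideal.Quotient.mk I p) = Ideal.Quotient.mk J (rename g p) := fun p => rfl
  have hq : ∀ (p : MvPolynomial σ 𝕜) m, q (p • m) = rename g p • q m := by
    intro p m
    obtain ⟨m, rfl⟩ := Ideal.Quotient.mk_surjective m
    change q (Ideal.Quotient.mk I (p * m)) = _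
    rw [hqmk, map_mul, map_mul, hqmk]
    rfl
  have hq0 : ∀ m, q m = 0 → m ∈ (Ideal.ofList rs • ⊤ : Submodule (MvPolynomial σ 𝕜) (MvPolynomial σ 𝕜 ⧸ I)) := by
    intro m hm
    obtain ⟨m, rfl⟩ := Ideal.Quotient.mk_surjective m
    rw [hqmk, Ideal.Quotient.eq_zero_iff_mem, ← hJ, ← Ideal.mem_comap (f := (rename g : MvPolynomial σ 𝕜 →ₐ[𝕜] MvPolynomial τ 𝕜)),
      Ideal.comap_map_of_surjective
      (rename g : MvPolynomial σ 𝕜 →ₐ[𝕜] MvPolynomial τ 𝕜) (rename_surjective g hg)] at hm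
    rw [mk_mem_smul_top, hrs]
    exact hm
  let Φ : ∀ n, (Fin n → MvPolynomial σ 𝕜) →+ (Fin n → MvPolynomial τ 𝕜) := fun n =>
    { toFun := fun v a => rename g (v a)
      map_zero' := funext fun a => map_zero _
      map_add' := fun v w => funext fun a => map_add _ _ _ }
  have hΦ : ∀ n (p : MvPolynomial σ 𝕜) m, Φ n (p • m) = rename g p • Φ n m :=
    fun n p m => funext fun a => map_mul (rename g) p (m a)
  have hΦ0 : ∀ n v, Φ n v = 0 ↔ v ∈ (Ideal.ofList rs • ⊤ : Submodule (MvPolynomial σ 𝕜) (Fin n → MvPolynomial σ 𝕜)) := by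
    intro n v
    rw [mem_ideal_smul_top_pi, hrs]
    exact funext_iff
  let d := fun i => renameExtend (τ := τ) (Φ (F.rank i)) (F.d i)
  have hd : ∀ i v, d i (Φ _ v) = Φ _ (F.d i v) := fun i v => renameExtend_rename g (hΦ _) _ v
  let aug := renameExtend (τ := τ) q.toAddMonoidHom F.aug
  have haug : ∀ v, aug (Φ _ v) = q (F.aug v) := fun v =>
    renameExtend_rename g (q := q.toAddMonoidHom) hq _ v
  have hlift : ∀ n v, ∃ w, Φ n w = v := fun n v => exists_lift_pi hg v
  -- Exactness modulo `rs` at `F_{i+1}`: the cokernel of `d (i + 1)` embeds in `F_i` with cokernel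
  -- `S/I` for `i = 0`, and the range of `d (i - 1)` otherwise, on which `rs` is regular.
  have hker : ∀ i v, F.d i v ∈ (Ideal.ofList rs • ⊤ : Submodule (MvPolynomial σ 𝕜) (Fin (F.rank i) → MvPolynomial σ 𝕜)) →
      ∃ w, F.d (i + 1) w - v ∈ (Ideal.ofList rs • ⊤ : Submodule (MvPolynomial σ 𝕜) (Fin (F.rank (i + 1)) → MvPolynomial σ 𝕜)) := by
    intro i v hv
    cases i with
    | zero =>
      exact exists_sub_mem_smul_top (F.exact_succ 0) F.exact_zero F.aug_surjective hI hv
    | succ i =>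
      refine exists_sub_mem_smul_top (F.exact_succ (i + 1)) (f₃ := (F.d i).rangeRestrict) ?_
        (LinearMap.surjective_rangeRestrict _) (F.isWeaklyRegular_range hS hI i) hv
      rw [LinearMap.exact_iff, LinearMap.ker_rangeRestrict]
      exact (F.exact_succ i).linearMap_ker_eq
  have hker0 : ∀ v, F.aug v ∈ (Ideal.ofList rs • ⊤ : Submodule (MvPolynomial σ 𝕜) (MvPolynomial σ 𝕜 ⧸ I)) →
      ∃ w, F.d 0 w - v ∈ (Ideal.ofList rs • ⊤ : Submodule (MvPolynomial σ 𝕜) (Fin (F.rank 0) → MvPolynomial σ 𝕜)) := by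
    intro v hv
    -- At `F_0` right exactness suffices: the fourth term is the zero module.
    refine exists_sub_mem_smul_top F.exact_zero
      (f₃ := (0 : (MvPolynomial σ 𝕜 ⧸ I) →ₗ[MvPolynomial σ 𝕜] PUnit)) ?_
      (fun x => ⟨0, Subsingleton.elim _ _⟩) ⟨fun i hi => ?_⟩ hv
    · exact fun m => ⟨fun _ => F.aug_surjective m, fun _ => rfl⟩
    · exact fun x y _ => Subsingleton.elim x y
  refine ⟨{
    rank := F.rank
    deg := F.deg
    d := d
    aug := aug
    d_homogeneous := ?_
    aug_homogeneous := ?_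
    aug_surjective := ?_
    exact_zero := ?_
    exact_succ := ?_
    minimal := ?_ }, fun i j => rfl⟩
  · intro i j v hv
    obtain ⟨w, hw, rfl⟩ := exists_lift_freeGrading hg hv
    exact (hd i w).symm ▸ rename_comp_mem_freeGrading g (F.d_homogeneous i j w hw)
  · intro j v hv
    obtain ⟨w, hw, rfl⟩ := exists_lift_freeGrading hg hv
    obtain ⟨p, hp, hpw⟩ := F.aug_homogeneous j w hw
    exact ⟨_, rename_mem_polyGrading g hp, ((haug w).trans (congrArg q hpw.symm)).symm⟩
  · intro m
    obtain ⟨p, rfl⟩ := Ideal.Quotient.mk_surjective m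
    obtain ⟨p, rfl⟩ := rename_surjective (R := 𝕜) g hg p
    obtain ⟨w, hw⟩ := F.aug_surjective (Ideal.Quotient.mk I p)
    exact ⟨Φ _ w, by rw [haug, hw, hqmk]⟩
  · intro v
    obtain ⟨v, rfl⟩ := hlift _ v
    constructor
    · intro h
      rw [haug] at h
      obtain ⟨w, hw⟩ := hker0 v (hq0 _ h)
      rw [← hΦ0, map_sub, sub_eq_zero, ← hd] at hw
      exact ⟨_, hw⟩
    · rintro ⟨w, hw⟩
      obtain ⟨w, rfl⟩ := hlift _ w
      rw [← hw, hd, haug, F.exact_zero.apply_apply_eq_zero, map_zero]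
  · intro i v
    obtain ⟨v, rfl⟩ := hlift _ v
    constructor
    · intro h
      rw [hd, hΦ0] at h
      obtain ⟨w, hw⟩ := hker i v h
      rw [← hΦ0, map_sub, sub_eq_zero, ← hd] at hw
      exact ⟨_, hw⟩
    · rintro ⟨w, hw⟩
      obtain ⟨w, rfl⟩ := hlift _ w
      rw [← hw, hd, hd, (F.exact_succ i).apply_apply_eq_zero, map_zero]
  · rintro i _ ⟨v, rfl⟩
    obtain ⟨v, rfl⟩ := hlift _ v
    rw [hd, mem_ideal_smul_top_pi]
    intro a
    rw [mem_span_range_X]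
    exact (constantCoeff_rename g _).trans
      (F.constantCoeff_eq_zero_of_mem_range (LinearMap.mem_range_self _ v) a)

end Specialization

/-! ### Edge ideals and nonzerodivisors. -/

section EdgeIdeals

variable {𝕜 V : Type*} [Field 𝕜]

/-- Membership in a monomial ideal is tested on monomials; since the ends of an edge are distinct,
divisibility by `X u * X v` only asks for nonzero exponents. -/
theorem mem_edgeIdeal {G : SimpleGraph V} {p : MvPolynomial V 𝕜} :
    p ∈ edgeIdeal 𝕜 G ↔ ∀ m, coeff m p ≠ 0 → ∃ u v, G.Adj u v ∧ m u ≠ 0 ∧ m v ≠ 0 := by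
  classical
  have h : {p : MvPolynomial V 𝕜 | ∃ u v, G.Adj u v ∧ p = X u * X v} =
      (fun s => monomial s (1 : 𝕜)) ''
        {m | ∃ u v, G.Adj u v ∧ m = Finsupp.single u 1 + Finsupp.single v 1} := by
    ext p
    constructor
    · rintro ⟨u, v, huv, rfl⟩
      exact ⟨_, ⟨u, v, huv, rfl⟩, by simp [X, monomial_mul]⟩
    · rintro ⟨_, ⟨u, v, huv, rfl⟩, rfl⟩
      exact ⟨u, v, huv, by simp [X, monomial_mul]⟩
  rw [edgeIdeal, h, mem_ideal_span_monomial_image]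
  refine forall_congr' fun m => ?_
  rw [mem_support_iff]
  refine imp_congr_right fun _ => ?_
  constructor
  · rintro ⟨_, ⟨u, v, huv, rfl⟩, hm⟩
    refine ⟨u, v, huv, ?_, ?_⟩
    · have := hm u
      simp at this
      omega
    · have := hm v
      simp at this
      omega
  · rintro ⟨u, v, huv, hu, hv⟩
    refine ⟨_, ⟨u, v, huv, rfl⟩, fun w => ?_⟩
    have := huv.ne
    rw [Finsupp.add_apply, Finsupp.single_apply, Finsupp.single_apply]
    split_ifs with h1 h2 h2
    · exact absurd (h1.trans h2.symm) this
    · subst h1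
      omega
    · subst h2
      omega
    · omega

theorem polyComponent_mem_edgeIdeal {G : SimpleGraph V} {p : MvPolynomial V 𝕜}
    (hp : p ∈ edgeIdeal 𝕜 G) (j : ℤ) : polyComponent j p ∈ edgeIdeal 𝕜 G := by
  rw [mem_edgeIdeal] at *
  intro m hm
  rw [coeff_polyComponent] at hm
  exact hp m fun h => hm (by rw [h, ite_self])

theorem constantCoeff_eq_zero_of_mem_edgeIdeal {G : SimpleGraph V} {p : MvPolynomial V 𝕜}
    (hp : p ∈ edgeIdeal 𝕜 G) : constantCoeff p = 0 := by
  by_contra h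
  obtain ⟨u, v, -, hu, -⟩ := mem_edgeIdeal.mp hp 0 h
  exact hu rfl

/-- If every neighbour of `a` is adjacent to every neighbour of `b`, then `X a - X b` is a
nonzerodivisor modulo the edge ideal. -/
theorem mem_edgeIdeal_of_sub_mul_mem {G : SimpleGraph V} {a b : V} (hab : a ≠ b)
    (h : ∀ u v, G.Adj a u → G.Adj b v → G.Adj u v) {p : MvPolynomial V 𝕜}
    (hp : (X a - X b) * p ∈ edgeIdeal 𝕜 G) : p ∈ edgeIdeal 𝕜 G := by
  classical
  let P : (V →₀ ℕ) → Prop := fun m => ∃ u v, G.Adj u v ∧ m u ≠ 0 ∧ m v ≠ 0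
  -- If `m * X a` is outside the ideal, then `m` does not occur in `p`. The coefficient of the
  -- product at `m * X a` is that of `p` at `m` minus that at `m * X a / X b`, which vanishes by
  -- induction on the exponent of `b`.
  have key : ∀ a b : V, a ≠ b → (X a - X b) * p ∈ edgeIdeal 𝕜 G →
      ∀ (k : ℕ) (m : V →₀ ℕ), m b = k → ¬ P (m + Finsupp.single a 1) → coeff m p = 0 := by
    intro a b hab hp k
    induction k with
    | zero =>
      intro m hm hP
      by_contra hc
      refine hP (mem_edgeIdeal.mp hp _ ?_)
      rw [sub_mul, coeff_sub, mul_comm (X a), mul_comm (X b), coeff_mul_X, coeff_mul_X', if_neg,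
        sub_zero]
      · exact hc
      · simp [hm, hab]
    | succ k ih =>
      intro m hm hP
      have h1 : m + Finsupp.single a 1 - Finsupp.single b 1 + Finsupp.single b 1 =
          m + Finsupp.single a 1 := by
        refine tsub_add_cancel_of_le fun v => ?_
        rw [Finsupp.add_apply, Finsupp.single_apply]
        split_ifs with hv
        · subst hv
          omega
        · omega
      have h2 := ih (m + Finsupp.single a 1 - Finsupp.single b 1) (by simp [hm, hab]) (by
        rintro ⟨u, v, huv, hu, hv⟩
        refine hP ⟨u, v, huv, ?_, ?_⟩
        · simp at hu ⊢
          omega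
        · simp at hv ⊢
          omega)
      by_contra hc
      refine hP (mem_edgeIdeal.mp hp _ ?_)
      rw [sub_mul, coeff_sub, mul_comm (X a), mul_comm (X b), coeff_mul_X, ← h1, coeff_mul_X, h2,
        sub_zero]
      exact hc
  rw [mem_edgeIdeal]
  intro m hm
  by_contra hP
  have h1 : P (m + Finsupp.single a 1) := by
    by_contra h1
    exact hm (key a b hab hp _ m rfl h1)
  have h2 : P (m + Finsupp.single b 1) := by
    by_contra h2
    refine hm (key b a hab.symm ?_ _ m rfl h2)
    rw [← neg_sub, neg_mul]
    exact Ideal.neg_mem_iff _ |>.mpr hp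
  -- An edge dividing `m * X c` but not `m` must contain `c`.
  have nb : ∀ c, P (m + Finsupp.single c 1) → ∃ u, G.Adj c u ∧ m u ≠ 0 := by
    rintro c ⟨u, v, huv, hu, hv⟩
    have hne := huv.ne
    rw [Finsupp.add_apply, Finsupp.single_apply] at hu hv
    by_cases hcu : c = u
    · subst hcu
      exact ⟨v, huv, by simpa [hne] using hv⟩
    · by_cases hcv : c = v
      · subst hcv
        exact ⟨u, huv.symm, by simpa [hcu] using hu⟩
      · exact absurd ⟨u, v, huv, by simpa [hcu] using hu, by simpa [hcv] using hv⟩ hP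
  obtain ⟨u, hu, hmu⟩ := nb a h1
  obtain ⟨v, hv, hmv⟩ := nb b h2
  exact hP ⟨u, v, h u v hu hv, hmu, hmv⟩

end EdgeIdeals

/-! ### Kernels of identifications of variables. -/

section Rename

variable {𝕜 σ τ : Type*} [Field 𝕜]

/-- For a section `s` of `g`, renaming along `s ∘ g` is the identity modulo `J`, and it kills the
kernel. -/
theorem ker_rename_le {g : σ → τ} (hg : Function.Surjective g) {J : Ideal (MvPolynomial σ 𝕜)}
    (hJ : ∀ a b, g a = g b → X a - X b ∈ J) :
    RingHom.ker (rename g : MvPolynomial σ 𝕜 →ₐ[𝕜] MvPolynomial τ 𝕜) ≤ J := by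
  intro p hp
  have h : (Ideal.Quotient.mkₐ 𝕜 J).comp ((rename (Function.surjInv hg)).comp (rename g)) =
      Ideal.Quotient.mkₐ 𝕜 J := by
    ext a
    simp only [AlgHom.comp_apply, rename_X]
    refine (Ideal.Quotient.eq).mpr (hJ _ _ ?_)
    exact Function.surjInv_eq hg _
  have h1 := AlgHom.congr_fun h p
  simp only [AlgHom.comp_apply] at h1
  rw [RingHom.mem_ker] at hp
  rw [hp, map_zero, map_zero] at h1
  exact Ideal.Quotient.eq_zero_iff_mem.mp h1.symm

end Rename

/-! ### Gluing whiskers one pair at a time. -/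

section FiberWhisker

variable {𝕜 V W : Type*} [Field 𝕜]

/-- The graph obtained from `G` by adding the vertices of `W`, where `w` is joined to exactly the
vertices in its fiber under `c`. -/
def fiberWhiskerGraph (G : SimpleGraph V) (c : V → W) : SimpleGraph (V ⊕ W) where
  Adj
    | .inl u, .inl v => G.Adj u v
    | .inl u, .inr w => c u = w
    | .inr w, .inl u => c u = w
    | .inr _, .inr _ => False
  symm := ⟨by
    rintro (u | i) (v | j) h
    · exact SimpleGraph.Adj.symm h
    · exact h
    · exact h
    · exact h⟩
  loopless := ⟨by
    rintro (u | i) h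
    · exact G.irrefl h
    · exact h⟩

theorem map_edgeIdeal_whiskerGraph (G : SimpleGraph V) (c : V → W) :
    (edgeIdeal 𝕜 (whiskerGraph G)).map
      (rename (Sum.map id c) : MvPolynomial (V ⊕ V) 𝕜 →ₐ[𝕜] MvPolynomial (V ⊕ W) 𝕜) =
      edgeIdeal 𝕜 (fiberWhiskerGraph G c) := by
  rw [edgeIdeal, Ideal.map_span, edgeIdeal]
  congr 1
  ext p
  constructor
  · rintro ⟨_, ⟨u, v, huv, rfl⟩, rfl⟩
    refine ⟨Sum.map id c u, Sum.map id c v, ?_, by simp⟩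
    rcases u with u | u <;> rcases v with v | v
    · exact huv
    · exact congrArg c huv
    · exact congrArg c huv
    · exact huv
  · rintro ⟨u, v, huv, rfl⟩
    rcases u with u | u <;> rcases v with v | v
    · exact ⟨_, ⟨.inl u, .inl v, huv, rfl⟩, by simp⟩
    · obtain rfl : c u = v := huv
      exact ⟨_, ⟨.inl u, .inr u, rfl, rfl⟩, by simp⟩
    · obtain rfl : c v = u := huv
      exact ⟨_, ⟨.inr v, .inl v, rfl, rfl⟩, by simp⟩
    · exact huv.elim

theorem sum_map_id_surjective {c : V → W} (hc : Function.Surjective c) :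
    Function.Surjective (Sum.map id c : V ⊕ V → V ⊕ W) :=
  Function.surjective_id.sumMap hc

theorem ker_rename_sum_map_id {c : V → W} (hc : Function.Surjective c)
    {J : Ideal (MvPolynomial (V ⊕ V) 𝕜)}
    (h₁ : ∀ a b, c a = c b → X (Sum.inr a) - X (Sum.inr b) ∈ J)
    (h₂ : ∀ p ∈ J, rename (Sum.map id c) p = 0) :
    RingHom.ker (rename (Sum.map id c) : MvPolynomial (V ⊕ V) 𝕜 →ₐ[𝕜] MvPolynomial (V ⊕ W) 𝕜)
      = J := by
  refine le_antisymm (ker_rename_le (sum_map_id_surjective hc) ?_) h₂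
  rintro (a | a) (b | b) hab
  · obtain rfl : a = b := by simpa using hab
    simp
  · simp at hab
  · simp at hab
  · exact h₁ a b (by simpa using hab)

/-- The differences `y_a - y_b` of whisker variables, for a list of pairs `(a, b)`. -/
noncomputable def pairDifferences (𝕜 : Type*) [Field 𝕜] {V : Type*} (L : List (V × V)) :
    List (MvPolynomial (V ⊕ V) 𝕜) :=
  L.map fun p => X (Sum.inr p.1) - X (Sum.inr p.2)

theorem take_pairDifferences (L : List (V × V)) (k : ℕ) :
    (pairDifferences 𝕜 L).take k = pairDifferences 𝕜 (L.take k) :=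
  List.map_take.symm

/-- Gluing the pairs of vertices of a list. -/
abbrev glue (L : List (V × V)) : V → Quot fun a b : V => (a, b) ∈ L := Quot.mk _

/-- Glued vertices are joined by a chain of listed pairs, along which the differences telescope. -/
theorem ker_rename_glue (L : List (V × V)) :
    RingHom.ker (rename (Sum.map id (glue L)) : MvPolynomial (V ⊕ V) 𝕜 →ₐ[𝕜] _) =
      Ideal.ofList (pairDifferences 𝕜 L) := by
  refine ker_rename_sum_map_id Quot.mk_surjective ?_ ?_
  · intro a b hab
    have := Quot.eqvGen_exact hab
    induction this with
    | rel a b h => exact Ideal.subset_span (List.mem_map.mpr ⟨(a, b), h, rfl⟩)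
    | refl a => simp
    | symm a b _ ih =>
      rw [← neg_sub]
      exact Ideal.neg_mem_iff _ |>.mpr (ih (Quot.eqvGen_sound ‹_›))
    | trans a b c _ _ ih₁ ih₂ =>
      rw [← sub_add_sub_cancel]
      exact Ideal.add_mem _ (ih₁ (Quot.eqvGen_sound ‹_›)) (ih₂ (Quot.eqvGen_sound ‹_›))
  · intro p hp
    rw [← RingHom.mem_ker]
    refine (Ideal.span_le.mpr ?_ : Ideal.ofList (pairDifferences 𝕜 L) ≤ _) hp
    intro q hq
    obtain ⟨⟨a, b⟩, hab, rfl⟩ := List.mem_map.mp hq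
    rw [SetLike.mem_coe, RingHom.mem_ker, map_sub, rename_X, rename_X, sub_eq_zero]
    exact congrArg (fun t => X (Sum.inr t)) (Quot.sound hab)

open RingTheory.Sequence

/-- Each pair of `L` is not yet glued by the previous ones. -/
theorem isWeaklyRegular_pairDifferences {L : List (V × V)}
    (hL : ∀ k (hk : k < L.length), glue (L.take k) L[k].1 ≠ glue (L.take k) L[k].2) :
    IsWeaklyRegular (MvPolynomial (V ⊕ V) 𝕜) (pairDifferences 𝕜 L) := by
  refine ⟨fun k hk => ?_⟩
  have hk' : k < L.length := by simpa [pairDifferences] using hk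
  rw [isSMulRegular_quotient_iff_mem_of_smul_mem]
  intro p hp
  simp only [smul_eq_mul, Ideal.mul_top] at hp ⊢
  rw [take_pairDifferences,
    ← ker_rename_glue, RingHom.mem_ker] at hp ⊢
  simp only [pairDifferences] at hp
  rw [List.getElem_map, map_mul, mul_eq_zero] at hp
  -- The quotient by the prefix embeds in a polynomial ring, a domain, so a nonzero element is
  -- regular.
  refine hp.resolve_left ?_
  rw [map_sub, rename_X, rename_X, sub_eq_zero]
  intro h
  exact hL k hk' (Sum.inr_injective (X_injective h))

/-- The neighbours of a glued whisker form its class under `glue`, so `hL` is the adjacency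
condition of `mem_edgeIdeal_of_sub_mul_mem`. -/
theorem isWeaklyRegular_pairDifferences_edgeIdeal {G : SimpleGraph V} {L : List (V × V)}
    (hL : ∀ k (hk : k < L.length) a b, glue (L.take k) a = glue (L.take k) L[k].1 →
      glue (L.take k) b = glue (L.take k) L[k].2 → G.Adj a b) :
    IsWeaklyRegular (MvPolynomial (V ⊕ V) 𝕜 ⧸ edgeIdeal 𝕜 (whiskerGraph G))
      (pairDifferences 𝕜 L) := by
  refine ⟨fun k hk => ?_⟩
  have hk' : k < L.length := by simpa [pairDifferences] using hk
  rw [isSMulRegular_quotient_iff_mem_of_smul_mem]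
  have hmem : ∀ p, Ideal.Quotient.mk (edgeIdeal 𝕜 (whiskerGraph G)) p ∈
      (Ideal.ofList ((pairDifferences 𝕜 L).take k) • ⊤ : Submodule (MvPolynomial (V ⊕ V) 𝕜) _) ↔
      rename (Sum.map id (glue (L.take k))) p ∈
        edgeIdeal 𝕜 (fiberWhiskerGraph G (glue (L.take k))) := by
    intro p
    rw [mk_mem_smul_top, ← map_edgeIdeal_whiskerGraph, take_pairDifferences,
      ← ker_rename_glue]
    rw [← Ideal.mem_comap (f := (rename (Sum.map id (glue (L.take k))) :
      MvPolynomial (V ⊕ V) 𝕜 →ₐ[𝕜] _)), Ideal.comap_map_of_surjective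
      (rename (Sum.map id (glue (L.take k))) : MvPolynomial (V ⊕ V) 𝕜 →ₐ[𝕜] _)
      (rename_surjective _ (sum_map_id_surjective Quot.mk_surjective))]
    rfl
  intro x hx
  obtain ⟨p, rfl⟩ := Ideal.Quotient.mk_surjective x
  change Ideal.Quotient.mk _ (_ * p) ∈ _ at hx
  rw [hmem] at hx ⊢
  simp only [pairDifferences, List.getElem_map, map_mul, map_sub, rename_X, Sum.map_inr] at hx
  refine mem_edgeIdeal_of_sub_mul_mem ?_ ?_ hx
  · intro h
    have h' := Sum.inr_injective h
    -- If the two classes coincided, `hL` would give a loop.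
    exact G.irrefl (hL k hk' L[k].1 L[k].1 rfl h')
  · rintro (u | u) (v | v) hu hv
    · exact hL k hk' u v hu hv
    · exact hv.elim
    · exact hu.elim
    · exact hu.elim

end FiberWhisker

/-! ### The differences attached to a clique partition. -/

namespace CliquePartition

variable {𝕜 V : Type*} [Field 𝕜] {G : SimpleGraph V} (π : CliquePartition G)

/-- The index of the clique which contains a given vertex. -/
noncomputable def index (v : V) : Fin π.r := (π.covers v).choose

theorem mem_block_index (v : V) : v ∈ π.block (π.index v) := (π.covers v).choose_spec

variable {π}

theorem index_eq {v : V} {i : Fin π.r} (h : v ∈ π.block i) : π.index v = i := by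
  by_contra hne
  exact Finset.disjoint_left.mp (π.pairwise_disjoint hne) (π.mem_block_index v) h

theorem index_eq_iff {v : V} {i : Fin π.r} : π.index v = i ↔ v ∈ π.block i :=
  ⟨fun h => h ▸ π.mem_block_index v, index_eq⟩

theorem index_surjective : Function.Surjective π.index := fun i =>
  ⟨_, index_eq (π.block_nonempty i).choose_spec⟩

theorem fiberWhiskerGraph_index : fiberWhiskerGraph G π.index = cliqueWhiskeredGraph G π := by
  ext u v
  rcases u with u | u <;> rcases v with v | v
  · exact Iff.rfl
  · exact index_eq_iff
  · exact index_eq_iff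
  · exact Iff.rfl

variable (x : ∀ i, Fin (π.block i).card ≃ {v // v ∈ π.block i})

/-- The first vertex of a clique. -/
noncomputable def base (i : Fin π.r) : V :=
  (x i ⟨0, Finset.card_pos.mpr (π.block_nonempty i)⟩).1

/-- The pairs of a vertex, not the first one of its clique, and the first vertex of its clique. -/
noncomputable def pairs : List (V × V) :=
  (List.finRange π.r).flatMap fun i =>
    (List.finRange (π.block i).card).tail.map fun j => ((x i j).1, base x i)

theorem whiskerDifferences_eq : whiskerDifferences 𝕜 π x = pairDifferences 𝕜 (pairs x) := by
  simp only [whiskerDifferences, pairDifferences, pairs, List.map_flatMap, List.map_map]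
  rfl

theorem mem_tail_finRange {n : ℕ} {j : Fin n} : j ∈ (List.finRange n).tail ↔ j.1 ≠ 0 := by
  cases n with
  | zero => exact j.elim0
  | succ n =>
    rw [List.finRange_succ, List.tail_cons]
    cases j using Fin.cases <;> simp

variable {x}

theorem mem_pairs {p : V × V} :
    p ∈ pairs x ↔ ∃ i j, j.1 ≠ 0 ∧ p = ((x i j).1, base x i) := by
  simp only [pairs, List.mem_flatMap, List.mem_finRange, true_and, List.mem_map, mem_tail_finRange,
    eq_comm (b := p)]

theorem index_apply (i : Fin π.r) (j : Fin (π.block i).card) : π.index (x i j).1 = i :=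
  index_eq (x i j).2

theorem index_base (i : Fin π.r) : π.index (base x i) = i := index_apply i _

theorem base_ne_apply (i i' : Fin π.r) {j : Fin (π.block i').card} (hj : j.1 ≠ 0) :
    base x i ≠ (x i' j).1 := by
  intro h
  have h1 := congrArg π.index h
  rw [index_base, index_apply] at h1
  subst h1
  have h2 := (x i).injective (Subtype.ext h)
  exact hj (congrArg Fin.val h2).symm

theorem nodup_pairs_fst : ((pairs x).map Prod.fst).Nodup := by
  rw [pairs, List.map_flatMap, List.nodup_flatMap]
  constructor
  · intro i _
    rw [List.map_map]
    exact ((List.nodup_finRange _).tail).map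
      (Subtype.val_injective.comp (x i).injective)
  · refine (List.nodup_finRange _).imp fun {i i'} hne v hv hv' => ?_
    simp only [List.map_map, List.mem_map, Function.comp_apply] at hv hv'
    obtain ⟨j, -, rfl⟩ := hv
    obtain ⟨j', -, h⟩ := hv'
    have := congrArg π.index h
    rw [index_apply, index_apply] at this
    exact hne this.symm

/-- Invariant of the first `k` gluings: they stay inside cliques and leave the vertex `(pairs
x)[k].1` alone in its class, because first entries are distinct and second entries are base
vertices. -/
theorem glue_pairs {k : ℕ} (hk : k < (pairs x).length) {a b : V}
    (hab : glue ((pairs x).take k) a = glue ((pairs x).take k) b) :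
    π.index a = π.index b ∧ (a = (pairs x)[k].1 ↔ b = (pairs x)[k].1) := by
  have := Quot.eqvGen_exact hab
  clear hab
  induction this with
  | rel a b h =>
    obtain ⟨l, hl, h⟩ := List.mem_take_iff_getElem.mp h
    have h1 : (a, b) ∈ pairs x := h ▸ List.getElem_mem _
    obtain ⟨i, j, hj, hab⟩ := mem_pairs.mp h1
    rw [Prod.mk.injEq] at hab
    obtain ⟨i', j', hj', hk'⟩ := mem_pairs.mp (List.getElem_mem hk)
    refine ⟨by rw [hab.1, hab.2, index_apply, index_base], iff_of_false ?_ ?_⟩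
    · intro ha
      have h2 := nodup_pairs_fst (x := x)
      have hl' : l < (pairs x).length := (lt_min_iff.mp hl).2
      have h3 : ((pairs x).map Prod.fst)[l]'(by simpa using hl') =
          ((pairs x).map Prod.fst)[k]'(by simpa using hk) := by
        rw [List.getElem_map, List.getElem_map, h]
        exact ha
      have := (h2.getElem_inj_iff).mp h3
      omega
    · rw [hab.2, hk']
      exact base_ne_apply i i' hj'
  | refl a => exact ⟨rfl, Iff.rfl⟩
  | symm a b _ ih => exact ⟨ih.1.symm, ih.2.symm⟩
  | trans a b c _ _ h₁ h₂ => exact ⟨h₁.1.trans h₂.1, h₁.2.trans h₂.2⟩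

theorem getElem_pairs {k : ℕ} (hk : k < (pairs x).length) :
    (pairs x)[k].2 ≠ (pairs x)[k].1 ∧ π.index (pairs x)[k].1 = π.index (pairs x)[k].2 := by
  obtain ⟨i, j, hj, h⟩ := mem_pairs.mp (List.getElem_mem hk)
  rw [h]
  exact ⟨base_ne_apply i i hj, by rw [index_apply, index_base]⟩

open RingTheory.Sequence

variable (x)

theorem isWeaklyRegular_whiskerDifferences :
    IsWeaklyRegular (MvPolynomial (V ⊕ V) 𝕜) (whiskerDifferences 𝕜 π x) := by
  rw [whiskerDifferences_eq]
  exact isWeaklyRegular_pairDifferences fun k hk h =>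
    (getElem_pairs hk).1 (((glue_pairs hk h).2).mp rfl)

theorem isWeaklyRegular_whiskerDifferences_edgeIdeal :
    IsWeaklyRegular (MvPolynomial (V ⊕ V) 𝕜 ⧸ edgeIdeal 𝕜 (whiskerGraph G))
      (whiskerDifferences 𝕜 π x) := by
  rw [whiskerDifferences_eq]
  refine isWeaklyRegular_pairDifferences_edgeIdeal fun k hk a b ha hb => ?_
  have h := getElem_pairs hk
  -- One class is the singleton `(pairs x)[k].1`; the other avoids that vertex and lies in the same
  -- clique.
  have ha' := (glue_pairs hk ha).2.mpr rfl
  have hb' : b ≠ (pairs x)[k].1 := fun h' => h.1 ((glue_pairs hk hb).2.mp h')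
  refine π.isClique (π.index a) (π.mem_block_index a) ?_ fun hab => hb' (hab ▸ ha')
  rw [Finset.mem_coe, ← index_eq_iff, (glue_pairs hk hb).1, ← h.2, ha']

theorem ofList_whiskerDifferences :
    Ideal.ofList (whiskerDifferences 𝕜 π x) = RingHom.ker (rename (Sum.map id π.index) :
      MvPolynomial (V ⊕ V) 𝕜 →ₐ[𝕜] MvPolynomial (V ⊕ Fin π.r) 𝕜) := by
  rw [whiskerDifferences_eq]
  refine (ker_rename_sum_map_id index_surjective ?_ ?_).symm
  · have key : ∀ a, X (Sum.inr a) - X (Sum.inr (base x (π.index a))) ∈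
        Ideal.ofList (pairDifferences 𝕜 (pairs x)) := by
      intro a
      obtain ⟨j, hj⟩ := (x (π.index a)).surjective ⟨a, π.mem_block_index a⟩
      -- The first vertex of a clique is its own base and contributes no listed pair; its difference
      -- is zero.
      by_cases h0 : j.1 = 0
      · have : base x (π.index a) = a := by
          rw [base, show (⟨0, _⟩ : Fin (π.block (π.index a)).card) = j from Fin.ext h0.symm, hj]
        rw [this, sub_self]
        exact Ideal.zero_mem _
      · refine Ideal.subset_span (List.mem_map.mpr ⟨(a, base x (π.index a)), ?_, rfl⟩)
        exact mem_pairs.mpr ⟨_, j, h0, by rw [hj]⟩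
    intro a b hab
    have := Ideal.sub_mem _ (key a) (key b)
    rwa [hab, sub_sub_sub_cancel_right] at this
  · intro p hp
    rw [← RingHom.mem_ker]
    refine (Ideal.span_le.mpr ?_ : Ideal.ofList (pairDifferences 𝕜 (pairs x)) ≤ _) hp
    intro q hq
    obtain ⟨p, hp, rfl⟩ := List.mem_map.mp hq
    obtain ⟨i, j, -, rfl⟩ := mem_pairs.mp hp
    rw [SetLike.mem_coe, RingHom.mem_ker, map_sub, rename_X, rename_X, sub_eq_zero, Sum.map_inr,
      Sum.map_inr, index_apply, index_base]

theorem comap_edgeIdeal_cliqueWhiskeredGraph :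
    (edgeIdeal 𝕜 (cliqueWhiskeredGraph G π)).comap (rename (Sum.map id π.index) :
      MvPolynomial (V ⊕ V) 𝕜 →ₐ[𝕜] MvPolynomial (V ⊕ Fin π.r) 𝕜) =
      edgeIdeal 𝕜 (whiskerGraph G) ⊔ Ideal.ofList (whiskerDifferences 𝕜 π x) := by
  rw [← fiberWhiskerGraph_index, ← map_edgeIdeal_whiskerGraph, Ideal.comap_map_of_surjective
    (rename (Sum.map id π.index) : MvPolynomial (V ⊕ V) 𝕜 →ₐ[𝕜] MvPolynomial (V ⊕ Fin π.r) 𝕜)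
    (rename_surjective _ (sum_map_id_surjective index_surjective)), ofList_whiskerDifferences]
  rfl

theorem isRegular_whiskerDifferences :
    IsRegular (MvPolynomial (V ⊕ V) 𝕜 ⧸ edgeIdeal 𝕜 (whiskerGraph G))
      (whiskerDifferences 𝕜 π x) := by
  refine ⟨isWeaklyRegular_whiskerDifferences_edgeIdeal x, fun h => ?_⟩
  have h1 : Ideal.Quotient.mk (edgeIdeal 𝕜 (whiskerGraph G)) 1 ∈
      (Ideal.ofList (whiskerDifferences 𝕜 π x) • ⊤ : Submodule (MvPolynomial (V ⊕ V) 𝕜) _) :=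
    h ▸ Submodule.mem_top
  rw [mk_mem_smul_top, ← comap_edgeIdeal_cliqueWhiskeredGraph, Ideal.mem_comap, map_one] at h1
  have := constantCoeff_eq_zero_of_mem_edgeIdeal h1
  simp at this

theorem exists_quotient_equiv :
    ∃ e : (MvPolynomial (V ⊕ V) 𝕜 ⧸
          (edgeIdeal 𝕜 (whiskerGraph G) ⊔ Ideal.ofList (whiskerDifferences 𝕜 π x))) ≃ₐ[𝕜]
        (MvPolynomial (V ⊕ Fin π.r) 𝕜 ⧸ edgeIdeal 𝕜 (cliqueWhiskeredGraph G π)),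
      (∀ v : V, e (Ideal.Quotient.mk _ (X (Sum.inl v))) =
        Ideal.Quotient.mk _ (X (Sum.inl v))) ∧
      ∀ i, ∀ v ∈ π.block i, e (Ideal.Quotient.mk _ (X (Sum.inr v))) =
        Ideal.Quotient.mk _ (X (Sum.inr i)) := by
  let f : MvPolynomial (V ⊕ V) 𝕜 →ₐ[𝕜]
      (MvPolynomial (V ⊕ Fin π.r) 𝕜 ⧸ edgeIdeal 𝕜 (cliqueWhiskeredGraph G π)) :=
    (Ideal.Quotient.mkₐ 𝕜 _).comp (rename (Sum.map id π.index))
  have hf : Function.Surjective f := (Ideal.Quotient.mkₐ_surjective 𝕜 _).comp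
    (rename_surjective _ (sum_map_id_surjective index_surjective))
  have hker : edgeIdeal 𝕜 (whiskerGraph G) ⊔ Ideal.ofList (whiskerDifferences 𝕜 π x) =
      RingHom.ker f := by
    rw [← comap_edgeIdeal_cliqueWhiskeredGraph]
    ext p
    exact (Ideal.Quotient.eq_zero_iff_mem (I := edgeIdeal 𝕜 (cliqueWhiskeredGraph G π))).symm
  have hmk : ∀ p, ((Ideal.quotientEquivAlgOfEq 𝕜 hker).trans
      (Ideal.quotientKerAlgEquivOfSurjective hf)) (Ideal.Quotient.mk _ p) = f p := fun p => rfl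
  refine ⟨_, fun v => (hmk _).trans ?_, fun i v hv => (hmk _).trans ?_⟩
  · simp [f]
  · simp [f, index_eq hv]

end CliquePartition

/-! ### The main theorem. -/

theorem mainTheorem7 {𝕜 : Type*} [Field 𝕜] {V : Type*} [Fintype V] (G : SimpleGraph V)
    (π : CliquePartition G) (x : ∀ i, Fin (π.block i).card ≃ {v // v ∈ π.block i}) :
    RingTheory.Sequence.IsRegular
        (MvPolynomial (V ⊕ V) 𝕜 ⧸ edgeIdeal 𝕜 (whiskerGraph G)) (whiskerDifferences 𝕜 π x) ∧
      (∃ e : (MvPolynomial (V ⊕ V) 𝕜 ⧸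
            (edgeIdeal 𝕜 (whiskerGraph G) ⊔ Ideal.ofList (whiskerDifferences 𝕜 π x))) ≃ₐ[𝕜]
          (MvPolynomial (V ⊕ Fin π.r) 𝕜 ⧸ edgeIdeal 𝕜 (cliqueWhiskeredGraph G π)),
        (∀ v : V, e (Ideal.Quotient.mk _ (X (Sum.inl v))) =
          Ideal.Quotient.mk _ (X (Sum.inl v))) ∧
        ∀ i, ∀ v ∈ π.block i, e (Ideal.Quotient.mk _ (X (Sum.inr v))) =
          Ideal.Quotient.mk _ (X (Sum.inr i))) ∧
      ∃ β : ℕ → ℤ → ℕ,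
        IsGradedBettiTable 𝕜 (V ⊕ Fin π.r)
          (quotGrading (edgeIdeal 𝕜 (cliqueWhiskeredGraph G π))) β ∧
        IsGradedBettiTable 𝕜 (V ⊕ V) (quotGrading (edgeIdeal 𝕜 (whiskerGraph G))) β := by
  refine ⟨CliquePartition.isRegular_whiskerDifferences x,
    CliquePartition.exists_quotient_equiv x, ?_⟩
  obtain ⟨F⟩ := nonempty_minimalGradedFreeResolution (I := edgeIdeal 𝕜 (whiskerGraph G))
    (fun p hp j => polyComponent_mem_edgeIdeal hp j)
    fun p hp => constantCoeff_eq_zero_of_mem_edgeIdeal hp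
  obtain ⟨F', hF'⟩ := exists_specialized_resolution
    (sum_map_id_surjective (CliquePartition.index_surjective (π := π)))
    ((map_edgeIdeal_whiskerGraph G _).trans
      (congrArg _ CliquePartition.fiberWhiskerGraph_index))
    (CliquePartition.ofList_whiskerDifferences x)
    (CliquePartition.isWeaklyRegular_whiskerDifferences x)
    (CliquePartition.isWeaklyRegular_whiskerDifferences_edgeIdeal x) F
  have hind := isIndependentGrading_quotGrading (I := edgeIdeal 𝕜 (whiskerGraph G))
    fun p hp j => polyComponent_mem_edgeIdeal hp j
  have hind' := isIndependentGrading_quotGrading (I := edgeIdeal 𝕜 (cliqueWhiskeredGraph G π))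
    fun p hp j => polyComponent_mem_edgeIdeal hp j
  -- The common table is read off from one resolution `F`; its specialization `F'` has the same
  -- degrees, and uniqueness covers all others.
  refine ⟨F.betti, ⟨⟨F'⟩, fun E i j => ?_⟩, ⟨F⟩, fun E i j => ?_⟩
  · rw [← hF']
    exact MinimalGradedFreeResolution.betti_eq_of_equiv i j hind' hind' (.refl _ _)
      (fun _ _ => Iff.rfl) E F'
  · exact MinimalGradedFreeResolution.betti_eq_of_equiv i j hind hind (.refl _ _)
      (fun _ _ => Iff.rfl) E F
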